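/- **Setting.** Let $X_1,\dots,X_n$ be Hausdorff spaces, $\mathbb X_n=\prod_{i=1}^n X_i$, and $0\le k<n$. For $F\subset\{1,\dots,n\}$ and $x,y\in\mathbb X_n$ let $x_F+y_{F^c}$ be the point with the coordinates of $x$ on $F$ and of $y$ on $F^c$. A kernel $\mathfrak I:\mathbb X_n\times\mathbb X_n\to\mathbb R$ is *$n$-symmetric* if $\mathfrak I(x_F+y_{F^c},\,y_F+x_{F^c})=\mathfrak I(x,y)$ for all $F,x,y$, and *complete $n$-symmetric* if moreover $\mathfrak I(x_F+z_{F^c},\,y_F+z_{F^c})=\mathfrak I(x_F+w_{F^c},\,y_F+w_{F^c})$ for all $F,x,y,z,w$. Let $\mathcal M_k(\mathbb X_n)$ be the space of finitely supported real measures on $\mathbb X_n$ that vanish on every box $\prod_i A_i$ with $A_i=X_i$ for at least $n-k+1$ indices, and let $\mathfrak M_k(\mathbb X_n)$ be the space of finite signed Radon measures that vanish on every such box with Borel sides. An $n$-symmetric kernel $\mathfrak I$ is *PDI$_k$* if $\iint(-1)^k\mathfrak I\,d\mu\,d\mu\ge 0$ for all $\mu\in\mathcal M_k(\mathbb X_n)$.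 The extended diagonal $\Delta_{k-1}^n$ is the set of pairs $(x,y)$ with $x_i=y_i$ for at least $n-k+1$ indices $i$. For a probability $Q$ and a partition $\pi$ of $\{1,\dots,n\}$ let $Q_\pi$ be the product of the marginals of $Q$ on the blocks of $\pi$. Let $\mathcal P[\mathfrak I]$ be the set of Radon probabilities $Q$ on $\mathbb X_n$ such that $$\int_{\mathbb X_n}\bigl|\mathfrak I(x_F+y_{F^c},\,z)\bigr|\,dQ_\pi(x)<\infty\quad\text{for all partitions }\pi,\ \text{all } F\subset\{1,\dots,n\}\text{ and all } y,z\in\mathbb X_n ,$$ and for $P\in\mathcal P[\mathfrak I]$ let $\mathcal P_k[\mathfrak I,P]=\{Q\in\mathcal P[\mathfrak I]: P-Q\in\mathfrak M_k(\mathbb X_n)\}$. For $x_0\in\mathbb X_n$ let $$K^{\mathfrak I}(x,y)=\iint(-1)^k\,\mathfrak I(u,v)\,d\mu_k^n[x,x_0](u)\,d\mu_k^n[y,x_0](v),$$ $$\mu_k^n[x,y]=\delta_x+\sum_{j=0}^{k-1}(-1)^{k-j}\binom{n-j-1}{n-k}\sum_{|F|=j}\delta_{x_F+y_{F^c}}.$$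 **Theorem.** Let $\mathfrak I$ be a continuous, complete $n$-symmetric PDI$_k$ kernel that vanishes on $\Delta_{k-1}^n$, and let $P\in\mathcal P[\mathfrak I]$. Then: 1. $\mathcal P_k[\mathfrak I,P]$ is convex. 2. Let $\lambda,\eta\in\mathcal P_k[\mathfrak I,P]$ and $x_0\in\mathbb X_n$. Then $K^{\mathfrak I}$ is positive definite. For $K=\mathfrak I$ and for $K=K^{\mathfrak I}$ the integral $\iint K\,d\lambda\,d\eta$ and, for every $z\in\mathbb X_n$, the integrals $K_\lambda(z)=\int K(x,z)\,d\lambda(x)$ and $K_\eta(z)=\int K(x,z)\,d\eta(x)$ converge absolutely. The functions $K^{\mathfrak I}_\lambda,K^{\mathfrak I}_\eta$ belong to the reproducing kernel Hilbert space $\mathcal H_{K^{\mathfrak I}}$ of $K^{\mathfrak I}$, and $$\iint(-1)^k\,\mathfrak I\,d[\lambda-\eta]\,d[\lambda-\eta]=\iint K^{\mathfrak I}\,d[\lambda-\eta]\,d[\lambda-\eta]=\bigl\|K^{\mathfrak I}_\lambda-K^{\mathfrak I}_\eta\bigr\|^2_{\mathcal H_{K^{\mathfrak I}}}\ \ge 0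 .$$ 3. The function $$(\lambda,\eta)\mapsto\sqrt{\iint(-1)^k\,\mathfrak I\,d[\lambda-\eta]\,d[\lambda-\eta]}$$ is a semi-metric on $\mathcal P_k[\mathfrak I,P]$: it is nonnegative, symmetric, zero when $\lambda=\eta$, and satisfies the triangle inequality. -/

import Mathlib

open MeasureTheory

namespace PDI

/-! Throughout, `x = (x_1, …, x_n)` is a point of `𝕏_n = ∏ i, X i` and
`F.piecewise x y` is the point whose coordinates in `F` are those of `x` and whose coordinates
outside `F` are those of `y`. -/

section Kernels

variable {n : ℕ} {X : Fin n → Type*}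

/-- `n`-symmetry: exchanging any set of coordinates between the two arguments does not change the
value of the kernel. -/
def IsNSymmetric (I : (∀ i, X i) → (∀ i, X i) → ℝ) : Prop :=
  ∀ (F : Finset (Fin n)) (x y : ∀ i, X i), I (F.piecewise x y) (F.piecewise y x) = I x y

/-- Complete `n`-symmetry: moreover, common coordinates of the two arguments may be replaced by any
other common coordinates. -/
def IsCompleteNSymmetric (I : (∀ i, X i) → (∀ i, X i) → ℝ) : Prop :=
  IsNSymmetric I ∧
    ∀ (F : Finset (Fin n)) (x₁ x₂ x₃ x₄ : ∀ i, X i),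
      I (F.piecewise x₁ x₃) (F.piecewise x₂ x₃) = I (F.piecewise x₁ x₄) (F.piecewise x₂ x₄)

/-- A finitely supported discrete real measure on `𝕏_n` is a finitely supported function `μ` of
point masses. It belongs to `𝓜_k(𝕏_n)` if it vanishes on every box `∏ i, A i` with at least
`n - k + 1` full sides. -/
def DiscreteM (k : ℕ) (μ : (∀ i, X i) →₀ ℝ) : Prop :=
  ∀ A : ∀ i, Set (X i), n + 1 ≤ k + {i | A i = Set.univ}.ncard →
    (μ.sum fun x c => (Set.univ.pi A).indicator (fun _ => c) x) = 0

/-- The double integral `∫∫ I(u, v) dμ(u) dν(v)` against discrete measures. -/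
noncomputable def discreteIntegral₂ {S : Type*} (I : S → S → ℝ) (μ ν : S →₀ ℝ) : ℝ :=
  μ.sum fun u a => ν.sum fun v b => a * b * I u v

/-- Positive definite independent kernel of order `k` in `𝕏_n`. -/
def IsPDI (k : ℕ) (I : (∀ i, X i) → (∀ i, X i) → ℝ) : Prop :=
  IsNSymmetric I ∧
    ∀ μ : (∀ i, X i) →₀ ℝ, DiscreteM k μ →
      0 ≤ discreteIntegral₂ (fun u v => (-1 : ℝ) ^ k * I u v) μ μ

/-- The kernel vanishes on the extended diagonal `Δ_{k-1}^n`, the set of pairs of points with at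
least `n - k + 1` equal coordinates. -/
def VanishesOnExtendedDiagonal (k : ℕ) (I : (∀ i, X i) → (∀ i, X i) → ℝ) : Prop :=
  ∀ x y : ∀ i, X i, n + 1 ≤ k + {i | x i = y i}.ncard → I x y = 0

/-- Positive definite kernels. -/
def IsPD {S : Type*} (K : S → S → ℝ) : Prop :=
  (∀ x y, K x y = K y x) ∧ ∀ c : S →₀ ℝ, 0 ≤ discreteIntegral₂ K c c

/-- The discrete measure
`μ_k^n[x, y] = δ_x + ∑_{j<k} (-1)^{k-j} binom(n-j-1, n-k) ∑_{|F|=j} δ_{x_F + y_{F^c}}`. -/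
noncomputable def mu (k : ℕ) (x y : ∀ i, X i) : (∀ i, X i) →₀ ℝ :=
  Finsupp.single x 1 +
    ∑ j ∈ Finset.range k, ∑ F ∈ (Finset.univ : Finset (Fin n)).powersetCard j,
      Finsupp.single (F.piecewise x y) ((-1 : ℝ) ^ (k - j) * ((n - j - 1).choose (n - k) : ℝ))

/-- The kernel `K^I(x, y) = ∫∫ (-1)^k I(u, v) dμ_k^n[x, x₀](u) dμ_k^n[y, x₀](v)`. -/
noncomputable def kernelK (k : ℕ) (I : (∀ i, X i) → (∀ i, X i) → ℝ) (x₀ x y : ∀ i, X i) : ℝ :=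
  discreteIntegral₂ (fun u v => (-1 : ℝ) ^ k * I u v) (mu k x x₀) (mu k y x₀)

/-- The Hilbert function space `H` on `S` is the reproducing kernel Hilbert space of `K`. -/
def IsRKHSOf {S : Type*} (H : Type*) [NormedAddCommGroup H] [InnerProductSpace ℝ H]
    [CompleteSpace H] [RKHS ℝ H S ℝ] (K : S → S → ℝ) : Prop :=
  ∀ x y : S, RKHS.kernel H x y 1 = K x y

end Kernels

section Measures

/-- A nonnegative Borel measure on a Hausdorff space is Radon if it is finite on compact sets and,
on all Borel sets, inner regular with respect to compact sets and outer regular with respect to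
open sets. -/
structure IsRadon {S : Type*} [TopologicalSpace S] [MeasurableSpace S] (μ : Measure S) : Prop where
  finite_on_compacts : ∀ K : Set S, IsCompact K → μ K < ⊤
  inner_regular : ∀ E : Set S, MeasurableSet E → μ E = ⨆ K ∈ {K | IsCompact K ∧ K ⊆ E}, μ K
  outer_regular : ∀ E : Set S, MeasurableSet E → μ E = ⨅ U ∈ {U | IsOpen U ∧ E ⊆ U}, μ U

variable {n : ℕ} {X : Fin n → Type*} [MeasurableSpace (∀ i, X i)]

/-- `f ∈ L¹(P_π)`, where `P_π` is the product of the marginals of `P` on the blocks of the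
partition `π` of the coordinates. That is, `P_π` is the law of the point whose coordinates in each
block `B` are those of `u B`, where the points `u B` are independent with law `P`. -/
def IntegrablePartition (P : ProbabilityMeasure (∀ i, X i))
    (π : Finpartition (Finset.univ : Finset (Fin n))) (f : (∀ i, X i) → ℝ) : Prop :=
  Integrable
    (fun u : π.parts → (∀ i, X i) =>
      f fun i => u ⟨π.part i, π.part_mem.2 (Finset.mem_univ i)⟩ i)
    (Measure.pi fun _ => (P : Measure (∀ i, X i)))

/-- The signed measure `P - Q`. -/
noncomputable def diff (P Q : ProbabilityMeasure (∀ i, X i)) : SignedMeasure (∀ i, X i) :=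
  (P : Measure (∀ i, X i)).toSignedMeasure - (Q : Measure (∀ i, X i)).toSignedMeasure

variable [∀ i, TopologicalSpace (X i)]

/-- `𝔐_k(𝕏_n)`: the finite signed Radon measures that vanish on all Borel boxes `∏ i, A i`
with at least `n - k + 1` full sides. -/
def RadonM (k : ℕ) (μ : SignedMeasure (∀ i, X i)) : Prop :=
  IsRadon μ.variation ∧
    ∀ A : ∀ i, Set (X i), (∀ i, MeasurableSet[borel (X i)] (A i)) →
      n + 1 ≤ k + {i | A i = Set.univ}.ncard → μ (Set.univ.pi A) = 0

/-- `𝒫[I]`: the Radon probabilities `Q` such that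
`∫ |I(x_F + (x₃)_{F^c}, x₄)| dQ_π(x) < ∞` for every partition `π` and subset `F` of the set of
coordinates and all points `x₃`, `x₄`. -/
def IntegrableProbabilities (I : (∀ i, X i) → (∀ i, X i) → ℝ) :
    Set (ProbabilityMeasure (∀ i, X i)) :=
  {Q | IsRadon (Q : Measure (∀ i, X i)) ∧
    ∀ (π : Finpartition (Finset.univ : Finset (Fin n))) (F : Finset (Fin n)) (x₃ x₄ : ∀ i, X i),
      IntegrablePartition Q π fun x => I (F.piecewise x x₃) x₄}

/-- `𝒫_k[I, P]`: the members `Q` of `𝒫[I]` with `P - Q ∈ 𝔐_k(𝕏_n)`. -/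
def IntegrableClass (k : ℕ) (I : (∀ i, X i) → (∀ i, X i) → ℝ)
    (P : ProbabilityMeasure (∀ i, X i)) : Set (ProbabilityMeasure (∀ i, X i)) :=
  {Q | Q ∈ IntegrableProbabilities I ∧ RadonM k (diff P Q)}

/-- The double integral `∫∫ K(u, v) dμ(u) dμ(v)` against a finite signed measure. -/
noncomputable def signedIntegral₂ {S : Type*} [MeasurableSpace S] (K : S → S → ℝ)
    (μ : SignedMeasure S) : ℝ :=
  ∫ᵛ v, (∫ᵛ u, K u v ∂<•μ) ∂<•μ

/-- The function `K_P(z) = ∫ K(x, z) dP(x)`. -/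
noncomputable def meanEmbedding {S : Type*} [MeasurableSpace S] (K : S → S → ℝ)
    (P : ProbabilityMeasure S) (z : S) : ℝ :=
  ∫ x, K x z ∂(P : Measure S)

/-- Absolute convergence of the integrals `K_P(z)`, `K_Q(z)` at every point `z`, and of
`∫∫ K dP dQ`. -/
def IntegrablePair {S : Type*} [MeasurableSpace S] (K : S → S → ℝ)
    (P Q : ProbabilityMeasure S) : Prop :=
  (∀ z, Integrable (fun x => K x z) (P : Measure S)) ∧
  (∀ z, Integrable (fun x => K x z) (Q : Measure S)) ∧
  Integrable (fun p : S × S => K p.1 p.2) ((P : Measure S).prod (Q : Measure S))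

/-- `d` is a semi-metric (pseudometric) on the set `A`. -/
def IsSemimetricOn {S : Type*} (A : Set S) (d : S → S → ℝ) : Prop :=
  (∀ a ∈ A, ∀ b ∈ A, 0 ≤ d a b) ∧ (∀ a ∈ A, d a a = 0) ∧
  (∀ a ∈ A, ∀ b ∈ A, d a b = d b a) ∧
  (∀ a ∈ A, ∀ b ∈ A, ∀ c ∈ A, d a c ≤ d a b + d b c)

end Measures

end PDI

/-!
The class `𝒫_k[I, P]` is tied together by the fact that its members have the same marginals on fewer
than `k` coordinates (`RadonM.marginalsAgree`). Everything rests on reducing the kernel to at most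
`k` coordinates at a time.

*Reduction to `k` coordinates.* For fixed `x`, `z` the function `F ↦ I(x_F + z_{F^c}, z)` lives on
the cube of subsets of the coordinates. Complete `n`-symmetry turns the double integral of `I`
against signed measures on the vertices into a convolution on this cube, so that the measures with
Walsh weights show that its Walsh coefficients of order at least `k`, multiplied by `(-1)^k`, are
nonnegative (`walsh_nonneg`). Comparing two of these coefficients bounds the value at a set with
more than `k` elements by the values at its proper subsets (`abs_piecewise_le_sum_ssubsets`), and
since `I` vanishes on the extended diagonal, only the sets with exactly `k` elements matter. On such
a set `H`, `2^k I(x_H + z, z)` is the squared Hilbert seminorm of `⊗_{i ∈ H} (δ_{x_i} - δ_{z_i})`,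
which gives a relaxed triangle inequality in each coordinate (`piecewise_le_sum_powerset`). The
outcome is `exists_abs_le_sum_base`: `|I(x, y)|` is at most a constant times a sum of values `|I(x_E
+ y_{H∖E} + z_{H^c}, z)|` with `E ⊆ H` and `|H| = k`.

*Integrability.* Let `x`, `y` be independent with laws `P`, `Q` in the class. If `E` and `H ∖ E` are
both nonempty, then each has fewer than `k` elements, so `Q` may be replaced by `P` and the pair
`(x_E, y_{H∖E})` has the law of a product of two block marginals of `P`; this is where the
integrability over all partitions is used (`integrable_prod_piecewise_piecewise`). The same
alternative proves that mixtures stay in the class: `k` coordinates either lie in one block of a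
partition, where a mixture is an average, or meet each block in fewer than `k` elements, where it
has the marginals of one of its components (`integrable_pi_mixture`).

*Measurability.* The Borel σ-algebra of a product may be larger than the product of the Borel
σ-algebras, on which boxes determine a measure, and a continuous kernel need not be measurable for
the σ-algebra of a product of two Borel measures. Radon measures are concentrated on `σ`-compact
sets, and on a product of those every continuous function is measurable for the product σ-algebra
(`measurable_indicator_pi_of_isSigmaCompact`). Hence the law of a continuous function of such points
is determined by box probabilities (`integrable_and_integral_eq_of_box_eq`).

*Energy.* The measure `μ_k^n[x, x₀]` belongs to `𝓜_k` by a binomial identity (`discreteM_mu`), so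
`K^I` is positive definite. All the terms of `K^I` except `(-1)^k I` contain an argument only
through fewer than `k` coordinates and do not contribute to the energy of a difference of two
members (`energyDiff_kernelK`). As `K^I(x, x)` is integrable, integration is a bounded functional on
the reproducing kernel Hilbert space, represented by the mean embedding (`IsRKHSOf.exists_mean`);
the energy is the squared distance of the mean embeddings, and the semi-metric is the distance.
-/

/-! ### Bounds for completely symmetric kernels by values in few coordinates -/

namespace PDI

section Discrete

variable {n k : ℕ} {X : Fin n → Type*} {I : (∀ i, X i) → (∀ i, X i) → ℝ}

lemma discreteIntegral₂_eq_linearCombination {S : Type*} (I : S → S → ℝ) (μ ν : S →₀ ℝ) :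
    discreteIntegral₂ I μ ν =
      Finsupp.linearCombination ℝ
        (fun u => Finsupp.linearCombination ℝ (fun v => I u v) ν) μ := by
  simp only [discreteIntegral₂, Finsupp.linearCombination_apply, smul_eq_mul]
  refine Finsupp.sum_congr fun u _ => ?_
  rw [Finsupp.mul_sum]
  exact Finsupp.sum_congr fun v _ => by ring

/-- The double integral as a bilinear map. -/
noncomputable def discreteBilin {S : Type*} (I : S → S → ℝ) :
    (S →₀ ℝ) →ₗ[ℝ] (S →₀ ℝ) →ₗ[ℝ] ℝ :=
  Finsupp.linearCombination ℝ fun u => Finsupp.linearCombination ℝ fun v => I u v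

lemma discreteBilin_apply {S : Type*} (I : S → S → ℝ) (μ ν : S →₀ ℝ) :
    discreteBilin I μ ν = discreteIntegral₂ I μ ν := by
  rw [discreteIntegral₂_eq_linearCombination, discreteBilin, Finsupp.linearCombination_apply,
    Finsupp.linearCombination_apply, Finsupp.sum, Finsupp.sum, LinearMap.sum_apply]
  rfl

lemma discreteIntegral₂_sum_single {S ι κ : Type*} (I : S → S → ℝ) (s : Finset ι) (t : Finset κ)
    (c : ι → ℝ) (d : κ → ℝ) (p : ι → S) (q : κ → S) :
    discreteIntegral₂ I (∑ i ∈ s, Finsupp.single (p i) (c i))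
      (∑ j ∈ t, Finsupp.single (q j) (d j)) =
      ∑ i ∈ s, ∑ j ∈ t, c i * d j * I (p i) (q j) := by
  rw [← discreteBilin_apply]
  simp only [map_sum, LinearMap.sum_apply, discreteBilin, Finsupp.linearCombination_single,
    LinearMap.smul_apply, smul_eq_mul]
  rw [Finset.sum_comm]
  exact Finset.sum_congr rfl fun i _ => Finset.sum_congr rfl fun j _ => by ring

/-- The space of discrete measures that vanish on boxes with few nontrivial sides. -/
noncomputable def discreteSubmodule (k : ℕ) (X : Fin n → Type*) :
    Submodule ℝ ((∀ i, X i) →₀ ℝ) where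
  carrier := {μ | DiscreteM k μ}
  zero_mem' := fun A _ => by simp
  add_mem' := fun {μ ν} hμ hν A hA => by
    rw [Finsupp.sum_add_index' (by simp) (by simp [Set.indicator]; grind), hμ A hA, hν A hA,
      add_zero]
  smul_mem' := fun c μ hμ A hA => by
    have h := hμ A hA
    rw [Finsupp.sum_smul_index' (by simp)]
    have : (μ.sum fun x a => (Set.univ.pi A).indicator (fun _ => c • a) x) =
        c * μ.sum fun x a => (Set.univ.pi A).indicator (fun _ => a) x := by
      rw [Finsupp.mul_sum]
      refine Finsupp.sum_congr fun x _ => ?_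
      by_cases hx : x ∈ Set.univ.pi A <;> simp [hx]
    rw [this, h, mul_zero]

lemma mem_discreteSubmodule {μ : (∀ i, X i) →₀ ℝ} :
    μ ∈ discreteSubmodule k X ↔ DiscreteM k μ := Iff.rfl

lemma box_sum_single {ι : Type*} (s : Finset ι) (p : ι → ∀ i, X i) (c : ι → ℝ)
    (A : ∀ i, Set (X i)) :
    ((∑ j ∈ s, Finsupp.single (p j) (c j)).sum fun x c => (Set.univ.pi A).indicator (fun _ => c) x)
      = ∑ j ∈ s, (Set.univ.pi A).indicator (fun _ => c j) (p j) := by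
  rw [← Finsupp.sum_finsetSum_index (by simp) (by simp [Set.indicator]; grind)]
  exact Finset.sum_congr rfl fun j _ => by rw [Finsupp.sum_single_index (by simp)]

/-- The value of a completely symmetric kernel depends only on the unordered pairs of
coordinates in which its arguments differ. -/
lemma IsCompleteNSymmetric.congr (hI : IsCompleteNSymmetric I) {p q p' q' : ∀ i, X i}
    (h : ∀ i, (p i = q i ∧ p' i = q' i) ∨ (p i = p' i ∧ q i = q' i) ∨
      (p i = q' i ∧ q i = p' i)) : I p q = I p' q' := by
  classical
  let F : Finset (Fin n) := {i | p i ≠ q i}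
  let G : Finset (Fin n) := {i | p i = p' i ∧ q i = q' i}
  have e1 : F.piecewise p p = p := by ext i; by_cases hi : i ∈ F <;> simp [hi]
  have e2 : F.piecewise q p = q := by
    ext i
    by_cases hi : i ∈ F
    · simp [hi]
    · rw [Finset.piecewise_eq_of_notMem _ _ _ hi]
      simpa [F] using hi
  have h1 := hI.2 F p q p p'
  rw [e1, e2] at h1
  rw [h1, ← hI.1 G p' q']
  congr 1
  · ext i
    have := h i
    by_cases hi : i ∈ F <;> by_cases hj : i ∈ G <;> simp [hi, hj] <;> simp [F, G] at hi hj <;> grind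
  · ext i
    have := h i
    by_cases hi : i ∈ F <;> by_cases hj : i ∈ G <;> simp [hi, hj] <;> simp [F, G] at hi hj <;> grind

lemma IsCompleteNSymmetric.symm (hI : IsCompleteNSymmetric I) (p q : ∀ i, X i) :
    I p q = I q p := hI.congr fun _ => Or.inr (Or.inr ⟨rfl, rfl⟩)

open scoped symmDiff in
lemma IsCompleteNSymmetric.piecewise_piecewise (hI : IsCompleteNSymmetric I)
    (F G : Finset (Fin n)) (x z : ∀ i, X i) :
    I (F.piecewise x z) (G.piecewise x z) = I ((F ∆ G).piecewise x z) z := by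
  refine hI.congr fun i => ?_
  by_cases hF : i ∈ F <;> by_cases hG : i ∈ G <;> simp [hF, hG, Finset.mem_symmDiff]

lemma VanishesOnExtendedDiagonal.piecewise_eq_zero (hd : VanishesOnExtendedDiagonal k I)
    {F : Finset (Fin n)} (hF : F.card < k) (x z : ∀ i, X i) : I (F.piecewise x z) z = 0 := by
  refine hd _ _ ?_
  have h1 : Fᶜ.card ≤ {i | F.piecewise x z i = z i}.ncard := by
    rw [← Set.ncard_coe_finset]
    exact Set.ncard_le_ncard (fun i hi => by simp at hi; simp [hi]) (Set.toFinite _)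
  rw [Finset.card_compl, Fintype.card_fin] at h1
  omega

/-- The signed measure on the vertices `x_G + z_{G^c}`, `G ⊆ F`, of a cube with the weights
of the Walsh function of `S`; for `S = F` it is the product of the measures `δ_{z_i} - δ_{x_i}`,
`i ∈ F`, and of point masses. -/
noncomputable def cubeMeasure (F S : Finset (Fin n)) (x z : ∀ i, X i) : (∀ i, X i) →₀ ℝ :=
  ∑ G ∈ F.powerset, Finsupp.single (G.piecewise x z) ((-1 : ℝ) ^ (G ∩ S).card)

open scoped symmDiff in
lemma neg_one_pow_card_symmDiff_inter (G H S : Finset (Fin n)) :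
    (-1 : ℝ) ^ ((G ∆ H) ∩ S).card = (-1) ^ (G ∩ S).card * (-1) ^ (H ∩ S).card := by
  have key : ∀ G : Finset (Fin n), (-1 : ℝ) ^ (G ∩ S).card = ∏ i ∈ S, if i ∈ G then -1 else 1 := by
    intro G
    rw [Finset.prod_ite, Finset.prod_const, Finset.prod_const_one, mul_one,
      Finset.filter_mem_eq_inter, Finset.inter_comm]
  rw [key, key, key, ← Finset.prod_mul_distrib]
  refine Finset.prod_congr rfl fun i _ => ?_
  by_cases hG : i ∈ G <;> by_cases hH : i ∈ H <;> simp [hG, hH, Finset.mem_symmDiff]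

lemma exists_mem_eq_univ_of_le_card {A : ∀ i, Set (X i)} {S : Finset (Fin n)}
    (hA : n + 1 ≤ k + {i | A i = Set.univ}.ncard) (hS : k ≤ S.card) :
    ∃ i ∈ S, A i = Set.univ := by
  by_contra! h
  have h1 : {i | A i = Set.univ}.ncard ≤ Sᶜ.card := by
    rw [← Set.ncard_coe_finset]
    refine Set.ncard_le_ncard (fun i hi => ?_) (Set.toFinite _)
    simp only [Finset.coe_compl, Set.mem_compl_iff, Finset.mem_coe]
    exact fun hiS => h i hiS hi
  rw [Finset.card_compl, Fintype.card_fin] at h1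
  have := S.card_le_univ
  rw [Fintype.card_fin] at this
  omega

open scoped symmDiff in
lemma discreteM_cubeMeasure {F S : Finset (Fin n)} (hSF : S ⊆ F) (hS : k ≤ S.card)
    (x z : ∀ i, X i) : DiscreteM k (cubeMeasure F S x z) := by
  intro A hA
  obtain ⟨j, hjS, hj⟩ := exists_mem_eq_univ_of_le_card hA hS
  rw [cubeMeasure, box_sum_single]
  have hmem : ∀ G : Finset (Fin n), (G ∆ {j}).piecewise x z ∈ Set.univ.pi A ↔
      G.piecewise x z ∈ Set.univ.pi A := by
    intro G
    simp only [Set.mem_univ_pi]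
    refine forall_congr' fun i => ?_
    by_cases hij : i = j
    · subst hij; simp [hj]
    · by_cases hi : i ∈ G <;> simp [hi, hij, Finset.mem_symmDiff]
  have hsign : ∀ G : Finset (Fin n), (-1 : ℝ) ^ ((G ∆ {j}) ∩ S).card = -(-1) ^ (G ∩ S).card := by
    intro G
    rw [neg_one_pow_card_symmDiff_inter, Finset.singleton_inter_of_mem hjS]
    simp
  refine Finset.sum_involution (fun G _ => G ∆ {j}) ?_ ?_ ?_ ?_
  · intro G _
    by_cases hG : G.piecewise x z ∈ Set.univ.pi A
    · rw [Set.indicator_of_mem hG, Set.indicator_of_mem ((hmem G).2 hG), hsign]; ring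
    · rw [Set.indicator_of_notMem hG, Set.indicator_of_notMem (mt (hmem G).1 hG), add_zero]
  · intro G _ _ h
    have : G ∆ {j} = G := h
    rw [symmDiff_eq_left] at this
    simp at this
  · intro G hG
    rw [Finset.mem_powerset] at hG ⊢
    intro i hi
    rw [Finset.mem_symmDiff] at hi
    rcases hi with hi | hi
    · exact hG hi.1
    · rw [Finset.mem_singleton.1 hi.1]; exact hSF hjS
  · intro G _
    exact symmDiff_symmDiff_cancel_right _ _

open scoped symmDiff in
lemma discreteIntegral₂_cubeMeasure (hI : IsCompleteNSymmetric I) (F S : Finset (Fin n))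
    (x z : ∀ i, X i) :
    discreteIntegral₂ (fun u v => (-1 : ℝ) ^ k * I u v) (cubeMeasure F S x z)
        (cubeMeasure F S x z) =
      2 ^ F.card * ((-1) ^ k *
        ∑ H ∈ F.powerset, (-1) ^ (H ∩ S).card * I (H.piecewise x z) z) := by
  rw [cubeMeasure, discreteIntegral₂_sum_single]
  have h : ∀ G ∈ F.powerset,
      (∑ G' ∈ F.powerset, (-1 : ℝ) ^ (G ∩ S).card * (-1) ^ (G' ∩ S).card *
        ((-1) ^ k * I (G.piecewise x z) (G'.piecewise x z))) =
      (-1) ^ k * ∑ H ∈ F.powerset, (-1) ^ (H ∩ S).card * I (H.piecewise x z) z := by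
    intro G hG
    rw [Finset.mul_sum]
    refine Finset.sum_nbij' (fun G' => G ∆ G') (fun G' => G ∆ G') ?_ ?_ ?_ ?_ ?_
    · intro G' hG'
      rw [Finset.mem_powerset] at *
      exact symmDiff_le_sup.trans (sup_le hG hG')
    · intro G' hG'
      rw [Finset.mem_powerset] at *
      exact symmDiff_le_sup.trans (sup_le hG hG')
    · intro G' _; exact symmDiff_symmDiff_cancel_left _ _
    · intro G' _; exact symmDiff_symmDiff_cancel_left _ _
    · intro G' _
      rw [hI.piecewise_piecewise, neg_one_pow_card_symmDiff_inter]; ring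
  rw [Finset.sum_congr rfl h, Finset.sum_const, Finset.card_powerset, nsmul_eq_mul]
  push_cast
  ring

/-- Positivity of the Walsh coefficients of order at least `k` of `F ↦ I(x_F + z, z)`. -/
lemma walsh_nonneg (hI : IsCompleteNSymmetric I) (hPDI : IsPDI k I) {F S : Finset (Fin n)}
    (hSF : S ⊆ F) (hS : k ≤ S.card) (x z : ∀ i, X i) :
    0 ≤ (-1 : ℝ) ^ k * ∑ H ∈ F.powerset, (-1) ^ (H ∩ S).card * I (H.piecewise x z) z := by
  have h := hPDI.2 _ (discreteM_cubeMeasure hSF hS x z)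
  rw [discreteIntegral₂_cubeMeasure hI] at h
  exact nonneg_of_mul_nonneg_right h (by positivity)

/-- Comparing the Walsh coefficients of `F` and of `F` minus a point, in which the top term has
opposite signs, bounds the top term by the others. -/
lemma abs_piecewise_le_sum_ssubsets (hI : IsCompleteNSymmetric I) (hPDI : IsPDI k I)
    {F : Finset (Fin n)} (hF : k < F.card) (x z : ∀ i, X i) :
    |I (F.piecewise x z) z| ≤ ∑ G ∈ F.ssubsets, |I (G.piecewise x z) z| := by
  have hpow : F.powerset = insert F F.ssubsets := by
    rw [Finset.ssubsets, Finset.insert_erase (Finset.mem_powerset_self F)]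
  have key : ∀ S, S ⊆ F → k ≤ S.card →
      0 ≤ (-1 : ℝ) ^ (k + S.card) * I (F.piecewise x z) z +
        ∑ G ∈ F.ssubsets, |I (G.piecewise x z) z| := by
    intro S hSF hS
    have h := walsh_nonneg hI hPDI hSF hS x z
    rw [hpow, Finset.sum_insert (by simp [Finset.mem_ssubsets]), mul_add, Finset.mul_sum,
      Finset.inter_eq_right.2 hSF, ← mul_assoc, ← pow_add] at h
    refine h.trans (add_le_add le_rfl (Finset.sum_le_sum fun G _ => ?_))
    refine (le_abs_self _).trans (le_of_eq ?_)
    simp [abs_mul]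
  obtain ⟨j, hj⟩ : F.Nonempty := Finset.card_pos.1 (by omega)
  have h1 := key F subset_rfl hF.le
  have h2 := key (F.erase j) (Finset.erase_subset _ _) (by rw [Finset.card_erase_of_mem hj]; omega)
  rw [Finset.card_erase_of_mem hj] at h2
  have hs : (-1 : ℝ) ^ (k + F.card) = -(-1) ^ (k + (F.card - 1)) := by
    rw [show k + F.card = k + (F.card - 1) + 1 by omega, pow_succ]; ring
  rw [hs] at h1
  rcases neg_one_pow_eq_or ℝ (k + (F.card - 1)) with h | h <;> rw [h] at h1 h2 <;>
    exact abs_le.2 ⟨by linarith, by linarith⟩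

lemma exists_abs_piecewise_le (hI : IsCompleteNSymmetric I) (hPDI : IsPDI k I)
    (hd : VanishesOnExtendedDiagonal k I) (m : ℕ) :
    ∃ C : ℝ, 0 ≤ C ∧ ∀ F : Finset (Fin n), F.card ≤ m → ∀ x z : ∀ i, X i,
      |I (F.piecewise x z) z| ≤
        C * ∑ H ∈ (Finset.univ : Finset (Fin n)).powersetCard k, |I (H.piecewise x z) z| := by
  induction m with
  | zero =>
    refine ⟨1, zero_le_one, fun F hF x z => ?_⟩
    rw [one_mul]
    rcases Nat.eq_zero_or_pos k with hk | hk
    · exact Finset.single_le_sum (f := fun H : Finset (Fin n) => |I (H.piecewise x z) z|)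
        (fun _ _ => abs_nonneg _) (by simp [Finset.mem_powersetCard]; omega)
    · rw [hd.piecewise_eq_zero (by omega), abs_zero]
      exact Finset.sum_nonneg fun _ _ => abs_nonneg _
  | succ m ih =>
    obtain ⟨C, hC, h⟩ := ih
    refine ⟨1 + 2 ^ (m + 1) * C, by positivity, fun F hF x z => ?_⟩
    set T := ∑ H ∈ (Finset.univ : Finset (Fin n)).powersetCard k, |I (H.piecewise x z) z| with hT
    have hT0 : 0 ≤ T := Finset.sum_nonneg fun _ _ => abs_nonneg _
    rcases lt_trichotomy F.card k with hk | hk | hk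
    · rw [hd.piecewise_eq_zero hk, abs_zero]; positivity
    · have h1 : |I (F.piecewise x z) z| ≤ T :=
        Finset.single_le_sum (f := fun H : Finset (Fin n) => |I (H.piecewise x z) z|)
          (fun _ _ => abs_nonneg _) (by simp [Finset.mem_powersetCard, hk])
      nlinarith [mul_nonneg (mul_nonneg (by positivity : (0 : ℝ) ≤ 2 ^ (m + 1)) hC) hT0]
    · have h1 := abs_piecewise_le_sum_ssubsets hI hPDI hk x z
      have h2 : ∑ G ∈ F.ssubsets, |I (G.piecewise x z) z| ≤ F.ssubsets.card • (C * T) := by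
        refine Finset.sum_le_card_nsmul _ _ _ fun G hG => h G ?_ x z
        have := Finset.card_lt_card (Finset.mem_ssubsets.1 hG)
        omega
      have h3 : (F.ssubsets.card : ℝ) ≤ 2 ^ (m + 1) := by
        have : F.ssubsets.card ≤ 2 ^ (m + 1) :=
          (Finset.card_le_card (Finset.erase_subset _ _)).trans
            (by rw [Finset.card_powerset]; exact Nat.pow_le_pow_right (by norm_num) hF)
        exact_mod_cast this
      rw [nsmul_eq_mul] at h2
      nlinarith [mul_le_mul_of_nonneg_right h3 (mul_nonneg hC hT0)]

/-- A kernel of order `k` is controlled by its values at pairs that differ in at most `k`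
coordinates. -/
lemma exists_abs_le_sum_powersetCard (hI : IsCompleteNSymmetric I) (hPDI : IsPDI k I)
    (hd : VanishesOnExtendedDiagonal k I) :
    ∃ C : ℝ, 0 ≤ C ∧ ∀ x z : ∀ i, X i,
      |I x z| ≤
        C * ∑ H ∈ (Finset.univ : Finset (Fin n)).powersetCard k, |I (H.piecewise x z) z| := by
  obtain ⟨C, hC, h⟩ := exists_abs_piecewise_le hI hPDI hd n
  exact ⟨C, hC, fun x z => by simpa using h Finset.univ (by simp) x z⟩

/-- For a bilinear form that is nonnegative on a subspace, the value at a sum of `m` vectors is at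
most `m` times the sum of the values. -/
lemma bilin_sum_le {V ι : Type*} [AddCommGroup V] [Module ℝ V] (B : V →ₗ[ℝ] V →ₗ[ℝ] ℝ)
    (M : Submodule ℝ V) (hB : ∀ v ∈ M, 0 ≤ B v v) (s : Finset ι) (v : ι → V)
    (hv : ∀ i ∈ s, v i ∈ M) :
    B (∑ i ∈ s, v i) (∑ i ∈ s, v i) ≤ s.card * ∑ i ∈ s, B (v i) (v i) := by
  -- The double sum is twice the difference of the two sides.
  have h : 0 ≤ ∑ i ∈ s, ∑ j ∈ s, B (v i - v j) (v i - v j) :=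
    Finset.sum_nonneg fun i hi => Finset.sum_nonneg fun j hj =>
      hB _ (M.sub_mem (hv i hi) (hv j hj))
  simp only [map_sub, LinearMap.sub_apply, Finset.sum_sub_distrib, Finset.sum_const,
    nsmul_eq_mul] at h
  have h2 : ∑ i ∈ s, ∑ j ∈ s, B (v j) (v i) = B (∑ i ∈ s, v i) (∑ i ∈ s, v i) := by
    simp [map_sum, LinearMap.sum_apply]
  have h3 : ∑ i ∈ s, ∑ j ∈ s, B (v i) (v j) = B (∑ i ∈ s, v i) (∑ i ∈ s, v i) := by
    rw [Finset.sum_comm, h2]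
  rw [h2, h3, ← Finset.mul_sum] at h
  linarith

lemma discreteIntegral₂_cubeMeasure_self (hI : IsCompleteNSymmetric I)
    (hd : VanishesOnExtendedDiagonal k I) {H : Finset (Fin n)} (hH : H.card = k)
    (x z : ∀ i, X i) :
    discreteIntegral₂ (fun u v => (-1 : ℝ) ^ k * I u v) (cubeMeasure H H x z)
        (cubeMeasure H H x z) = 2 ^ k * I (H.piecewise x z) z := by
  rw [discreteIntegral₂_cubeMeasure hI, Finset.sum_eq_single_of_mem H (Finset.mem_powerset_self H),
    Finset.inter_self, hH, ← mul_assoc ((-1 : ℝ) ^ k), ← pow_add, ← two_mul, pow_mul]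
  · norm_num
  · intro G hG hGH
    have := Finset.card_lt_card (lt_of_le_of_ne (Finset.mem_powerset.1 hG) hGH)
    rw [hd.piecewise_eq_zero (by omega), mul_zero]

open scoped symmDiff in
/-- The expansion of the product over `i ∈ H` of
`δ_{x_i} - δ_{y_i} = (δ_{x_i} - δ_{z_i}) - (δ_{y_i} - δ_{z_i})`. -/
lemma sum_smul_cubeMeasure (H : Finset (Fin n)) (x y z : ∀ i, X i) :
    ∑ E ∈ H.powerset, (-1 : ℝ) ^ E.card •
        cubeMeasure H H (E.piecewise x (H.piecewise y z)) z =
      (-1 : ℝ) ^ H.card • cubeMeasure H H x (H.piecewise y z) := by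
  simp only [cubeMeasure, Finset.smul_sum, Finsupp.smul_single, smul_eq_mul]
  rw [Finset.sum_comm, Finset.sum_eq_single_of_mem H (Finset.mem_powerset_self H)]
  · refine Finset.sum_congr rfl fun E hE => ?_
    rw [Finset.mem_powerset] at hE
    rw [Finset.inter_eq_left.2 hE, Finset.inter_self, mul_comm]
    congr 1
    ext i
    by_cases hi : i ∈ H
    · simp [hi]
    · have : i ∉ E := fun h => hi (hE h)
      simp [hi, this]
  · intro G hG hGH
    rw [Finset.mem_powerset] at hG
    obtain ⟨j, hjH, hjG⟩ := Finset.exists_of_ssubset (lt_of_le_of_ne hG hGH)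
    refine Finset.sum_involution (fun E _ => E ∆ {j}) ?_ ?_ ?_ ?_
    · intro E hE
      have hp : G.piecewise ((E ∆ {j}).piecewise x (H.piecewise y z)) z =
          G.piecewise (E.piecewise x (H.piecewise y z)) z := by
        ext i
        by_cases hi : i ∈ G
        · have hij : i ≠ j := fun h => hjG (h ▸ hi)
          by_cases hiE : i ∈ E <;> simp [hi, hiE, hij, Finset.mem_symmDiff]
        · simp [hi]
      have hs := neg_one_pow_card_symmDiff_inter E {j} Finset.univ
      simp only [Finset.inter_univ, Finset.card_singleton, pow_one] at hs
      rw [hp, hs, ← Finsupp.single_add]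
      simp
    · intro E _ _ h
      have : E ∆ {j} = E := h
      rw [symmDiff_eq_left] at this
      simp at this
    · intro E hE
      rw [Finset.mem_powerset] at hE ⊢
      intro i hi
      rw [Finset.mem_symmDiff] at hi
      rcases hi with hi | hi
      · exact hE hi.1
      · rw [Finset.mem_singleton.1 hi.1]; exact hjH
    · intro E _
      exact symmDiff_symmDiff_cancel_right _ _

/-- A relaxed triangle inequality in each of the `k` coordinates in which the arguments differ. -/
lemma piecewise_le_sum_powerset (hI : IsCompleteNSymmetric I) (hPDI : IsPDI k I)
    (hd : VanishesOnExtendedDiagonal k I) {H : Finset (Fin n)} (hH : H.card = k)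
    (x y z : ∀ i, X i) :
    |I (H.piecewise x y) y| ≤
      2 ^ k * ∑ E ∈ H.powerset, |I (E.piecewise x ((H \ E).piecewise y z)) z| := by
  set B := discreteBilin (fun u v => (-1 : ℝ) ^ k * I u v) with hBdef
  have hB : ∀ v ∈ discreteSubmodule k X, 0 ≤ B v v := fun v hv => by
    rw [hBdef, discreteBilin_apply]; exact hPDI.2 v hv
  have hcube : ∀ x z : ∀ i, X i, cubeMeasure H H x z ∈ discreteSubmodule k X := fun x z =>
    discreteM_cubeMeasure subset_rfl hH.ge x z
  have hself : ∀ x z : ∀ i, X i, B (cubeMeasure H H x z) (cubeMeasure H H x z) =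
      2 ^ k * I (H.piecewise x z) z := fun x z => by
    rw [hBdef, discreteBilin_apply, discreteIntegral₂_cubeMeasure_self hI hd hH]
  have hnonneg : ∀ x z : ∀ i, X i, 0 ≤ I (H.piecewise x z) z := fun x z => by
    have := hB _ (hcube x z)
    rw [hself] at this
    exact nonneg_of_mul_nonneg_right this (by positivity)
  have hsq : ∀ m : ℕ, (-1 : ℝ) ^ m * (-1) ^ m = 1 := fun m => by
    rw [← pow_add, ← two_mul, pow_mul]; norm_num
  have hsmul : ∀ (m : ℕ) (v : (∀ i, X i) →₀ ℝ),
      B ((-1 : ℝ) ^ m • v) ((-1 : ℝ) ^ m • v) = B v v := fun m v => by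
    rw [map_smul, map_smul, LinearMap.smul_apply, smul_smul, hsq, one_smul]
  have h := bilin_sum_le B _ hB H.powerset
    (fun E => (-1 : ℝ) ^ E.card • cubeMeasure H H (E.piecewise x (H.piecewise y z)) z)
    (fun E _ => Submodule.smul_mem _ _ (hcube _ _))
  rw [sum_smul_cubeMeasure, hsmul, hself, Finset.card_powerset, hH] at h
  simp only [hsmul, hself, ← Finset.mul_sum] at h
  rw [abs_of_nonneg (hnonneg x y)]
  have e1 : I (H.piecewise x (H.piecewise y z)) (H.piecewise y z) = I (H.piecewise x y) y :=
    hI.congr fun i => by by_cases hi : i ∈ H <;> simp [hi]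
  have e2 : ∀ E ∈ H.powerset, I (H.piecewise (E.piecewise x (H.piecewise y z)) z) z ≤
      |I (E.piecewise x ((H \ E).piecewise y z)) z| := by
    intro E hE
    rw [Finset.mem_powerset] at hE
    refine le_of_eq_of_le ?_ (le_abs_self _)
    congr 1
    ext i
    by_cases hi : i ∈ H
    · by_cases hiE : i ∈ E <;> simp [hi, hiE]
    · have : i ∉ E := fun h => hi (hE h)
      simp [hi, this]
  have h3 := Finset.sum_le_sum e2
  rw [e1] at h
  push_cast at h
  have h4 : I (H.piecewise x y) y ≤ 2 ^ k * ∑ E ∈ H.powerset,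
      I (H.piecewise (E.piecewise x (H.piecewise y z)) z) z := by
    have h2 : (0 : ℝ) < 2 ^ k := by positivity
    refine le_of_mul_le_mul_left (h.trans (le_of_eq ?_)) h2
    ring
  exact h4.trans (mul_le_mul_of_nonneg_left h3 (by positivity))

/-- Comparison of `I(x, y)` with values at a base point `z`, in which each summand involves at most
`k` of the coordinates of `x` and `y`. -/
lemma exists_abs_le_sum_base (hI : IsCompleteNSymmetric I) (hPDI : IsPDI k I)
    (hd : VanishesOnExtendedDiagonal k I) :
    ∃ C : ℝ, 0 ≤ C ∧ ∀ x y z : ∀ i, X i,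
      |I x y| ≤ C * ∑ H ∈ (Finset.univ : Finset (Fin n)).powersetCard k, ∑ E ∈ H.powerset,
        |I (E.piecewise x ((H \ E).piecewise y z)) z| := by
  obtain ⟨C, hC, h⟩ := exists_abs_le_sum_powersetCard hI hPDI hd
  refine ⟨C * 2 ^ k, by positivity, fun x y z => (h x y).trans ?_⟩
  rw [mul_assoc, Finset.mul_sum (a := (2 : ℝ) ^ k)]
  refine mul_le_mul_of_nonneg_left (Finset.sum_le_sum fun H hH => ?_) hC
  exact piecewise_le_sum_powerset hI hPDI hd (Finset.mem_powersetCard.1 hH).2 x y z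

end Discrete

end PDI

/-! ### The kernel `K^I` is positive definite -/

namespace PDI

section BasePoint

variable {n k : ℕ} {X : Fin n → Type*} {I : (∀ i, X i) → (∀ i, X i) → ℝ}

/-- The mass that `μ_k^n[x, y]` puts on the vertex `x_F + y_{F^c}`. -/
noncomputable def muCoeff (n k : ℕ) (F : Finset (Fin n)) : ℝ :=
  (if F = Finset.univ then 1 else 0) +
    if F.card < k then (-1 : ℝ) ^ (k - F.card) * ((n - F.card - 1).choose (n - k) : ℝ) else 0

lemma mu_eq_sum (hkn : k < n) (x y : ∀ i, X i) :
    mu k x y = ∑ F : Finset (Fin n), Finsupp.single (F.piecewise x y) (muCoeff n k F) := by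
  simp only [muCoeff, Finsupp.single_add, Finset.sum_add_distrib, mu]
  congr 1
  · rw [Finset.sum_eq_single_of_mem Finset.univ (Finset.mem_univ _)]
    · simp
    · intro F _ hF; simp [hF]
  · rw [← Finset.powerset_univ, Finset.sum_powerset]
    refine Finset.sum_subset_zero_on_sdiff ?_ ?_ ?_
    · intro j hj
      simp only [Finset.mem_range, Finset.card_univ, Fintype.card_fin] at hj ⊢
      omega
    · intro j hj
      simp only [Finset.mem_sdiff, Finset.mem_range, not_lt] at hj
      refine Finset.sum_eq_zero fun F hF => ?_
      rw [(Finset.mem_powersetCard.1 hF).2, if_neg (by omega), Finsupp.single_zero]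
    · intro j hj
      refine Finset.sum_congr rfl fun F hF => ?_
      rw [(Finset.mem_powersetCard.1 hF).2, if_pos (Finset.mem_range.1 hj)]

/-- The binomial identity behind the weights of `μ_k^n[x, y]`. Pascal's rule and a shift of the
summation index lower both parameters. -/
lemma sum_neg_one_pow_choose_mul_choose (d r : ℕ) :
    ∑ i ∈ Finset.range (d + 1),
      (-1 : ℝ) ^ i * ((d + 1 + r).choose i : ℝ) * ((d + r - i).choose r : ℝ) = (-1) ^ d := by
  induction r with
  | zero =>
    have h := (Commute.all (-1 : ℝ) 1).add_pow (d + 1)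
    simp only [neg_add_cancel, one_pow, mul_one, ne_eq, Nat.succ_ne_zero, not_false_eq_true,
      zero_pow] at h
    rw [Finset.sum_range_succ] at h
    simp only [add_zero, Nat.choose_zero_right, Nat.cast_one, mul_one, Nat.choose_self] at h ⊢
    rw [pow_succ] at h
    linarith
  | succ r ih =>
    rw [← ih]
    have e : ∀ i ∈ Finset.range (d + 1),
        (-1 : ℝ) ^ i * ((d + 1 + (r + 1)).choose i : ℝ) * ((d + (r + 1) - i).choose (r + 1) : ℝ) =
        (-1 : ℝ) ^ i * ((d + 1 + r).choose i : ℝ) * ((d + r - i).choose r : ℝ) +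
        ((-1 : ℝ) ^ i * (if i = 0 then 0 else ((d + 1 + r).choose (i - 1) : ℝ)) *
          ((d + r + 1 - i).choose (r + 1) : ℝ) +
        (-1 : ℝ) ^ i * ((d + 1 + r).choose i : ℝ) * ((d + r - i).choose (r + 1) : ℝ)) := by
      intro i hi
      have hi : i ≤ d := Nat.lt_succ_iff.1 (Finset.mem_range.1 hi)
      have h1 : d + (r + 1) - i = (d + r - i) + 1 := by omega
      have h2 : d + r + 1 - i = (d + r - i) + 1 := by omega
      rw [h1, h2, Nat.choose_succ_succ]
      rcases i with _ | i
      · simp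
      · rw [show d + 1 + (r + 1) = (d + 1 + r) + 1 by omega, Nat.choose_succ_succ (d + 1 + r) i]
        simp
        ring
    rw [Finset.sum_congr rfl e, Finset.sum_add_distrib, Finset.sum_add_distrib]
    have h3 : ∑ i ∈ Finset.range (d + 1), (-1 : ℝ) ^ i *
          (if i = 0 then 0 else ((d + 1 + r).choose (i - 1) : ℝ)) *
          ((d + r + 1 - i).choose (r + 1) : ℝ) =
        - ∑ i ∈ Finset.range d,
          (-1 : ℝ) ^ i * ((d + 1 + r).choose i : ℝ) * ((d + r - i).choose (r + 1) : ℝ) := by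
      rw [Finset.sum_range_succ', ← Finset.sum_neg_distrib]
      simp only [if_true, mul_zero, zero_mul, add_zero]
      refine Finset.sum_congr rfl fun i _ => ?_
      rw [show d + r + 1 - (i + 1) = d + r - i by omega, pow_succ]
      simp
    rw [h3, Finset.sum_range_succ (n := d) (fun i => (-1 : ℝ) ^ i * ((d + 1 + r).choose i : ℝ) *
      ((d + r - i).choose (r + 1) : ℝ))]
    rw [show d + r - d = r by omega, Nat.choose_succ_self]
    simp

/-- The weights of `μ_k^n[x, y]` annihilate the monomials of degree less than `k`. -/
lemma sum_muCoeff_superset (hkn : k < n) {U : Finset (Fin n)} (hU : U.card < k) :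
    ∑ F : Finset (Fin n), (if U ⊆ F then muCoeff n k F else 0) = 0 := by
  have h1 : ∑ F : Finset (Fin n), (if U ⊆ F then muCoeff n k F else 0) =
      1 + ∑ F : Finset (Fin n), (if U ⊆ F then
        (if F.card < k then (-1 : ℝ) ^ (k - F.card) * ((n - F.card - 1).choose (n - k) : ℝ) else 0)
        else 0) := by
    have e : ∀ F : Finset (Fin n), (if U ⊆ F then muCoeff n k F else 0) =
        (if F = Finset.univ then 1 else 0) + (if U ⊆ F then
        (if F.card < k then (-1 : ℝ) ^ (k - F.card) * ((n - F.card - 1).choose (n - k) : ℝ) else 0)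
        else 0) := by
      intro F
      by_cases hF : F = Finset.univ
      · simp [hF, muCoeff]
      · simp [hF, muCoeff]
    rw [Finset.sum_congr rfl fun F _ => e F, Finset.sum_add_distrib, Finset.sum_ite_eq',
      if_pos (Finset.mem_univ _)]
  rw [h1, ← Finset.sum_filter]
  have h2 : ∑ F : Finset (Fin n) with U ⊆ F,
      (if F.card < k then (-1 : ℝ) ^ (k - F.card) * ((n - F.card - 1).choose (n - k) : ℝ) else 0) =
      ∑ V ∈ Uᶜ.powerset, (fun m => if U.card + m < k then
        (-1 : ℝ) ^ (k - (U.card + m)) * ((n - (U.card + m) - 1).choose (n - k) : ℝ) else 0)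
        V.card := by
    refine Finset.sum_nbij' (fun F => F \ U) (fun V => U ∪ V) ?_ ?_ ?_ ?_ ?_
    · intro F _
      rw [Finset.mem_powerset]
      intro i hi
      simp only [Finset.mem_sdiff] at hi
      simpa using hi.2
    · intro V _; simp
    · intro F hF
      exact Finset.union_sdiff_of_subset (by simpa using hF)
    · intro V hV
      rw [Finset.union_sdiff_left]
      exact Finset.sdiff_eq_self_of_disjoint
        (Finset.disjoint_left.2 fun i hi hiU => by
          simpa [hiU] using Finset.mem_powerset.1 hV hi)
    · intro F hF
      have hUF : U ⊆ F := by simpa using hF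
      have : U.card + (F \ U).card = F.card := by
        rw [add_comm, Finset.card_sdiff_add_card_eq_card hUF]
      simp only [this]
  rw [h2, Finset.sum_powerset_apply_card (fun m => if U.card + m < k then
        (-1 : ℝ) ^ (k - (U.card + m)) * ((n - (U.card + m) - 1).choose (n - k) : ℝ) else 0),
    Finset.card_compl, Fintype.card_fin]
  obtain ⟨d, hd⟩ : ∃ d, k = U.card + d + 1 := ⟨k - U.card - 1, by omega⟩
  obtain ⟨r, hr⟩ : ∃ r, n = k + r := ⟨n - k, by omega⟩
  have h3 := sum_neg_one_pow_choose_mul_choose d r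
  set u := U.card
  have h4 : ∑ m ∈ Finset.range (n - u + 1), (n - u).choose m • (if u + m < k then
        (-1 : ℝ) ^ (k - (u + m)) * ((n - (u + m) - 1).choose (n - k) : ℝ) else 0) =
      -(-1) ^ d * ∑ i ∈ Finset.range (d + 1),
      (-1 : ℝ) ^ i * ((d + 1 + r).choose i : ℝ) * ((d + r - i).choose r : ℝ) := by
    rw [Finset.mul_sum]
    symm
    refine Finset.sum_subset_zero_on_sdiff ?_ ?_ ?_
    · intro m hm
      simp only [Finset.mem_range] at hm ⊢
      omega
    · intro m hm
      simp only [Finset.mem_sdiff, Finset.mem_range, not_lt] at hm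
      rw [if_neg (by omega), smul_zero]
    · intro m hm
      have hm : m ≤ d := Nat.lt_succ_iff.1 (Finset.mem_range.1 hm)
      rw [if_pos (by omega), nsmul_eq_mul, show n - u = d + 1 + r by omega,
        show n - (u + m) - 1 = d + r - m by omega, show n - k = r by omega,
        show k - (u + m) = d - m + 1 by omega]
      have : (-1 : ℝ) ^ d = (-1) ^ (d - m) * (-1) ^ m := by rw [← pow_add]; congr 1; omega
      have hsq : (-1 : ℝ) ^ m * (-1) ^ m = 1 := by rw [← pow_add, ← two_mul, pow_mul]; norm_num
      rw [this, pow_succ]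
      linear_combination (-1 : ℝ) * (-1) ^ (d - m) * ((d + 1 + r).choose m : ℝ) *
        ((d + r - m).choose r : ℝ) * hsq
  rw [h4, h3]
  have hsq : (-1 : ℝ) ^ d * (-1) ^ d = 1 := by rw [← pow_add, ← two_mul, pow_mul]; norm_num
  linear_combination -hsq

lemma discreteM_mu (hkn : k < n) (x y : ∀ i, X i) : DiscreteM k (mu k x y) := by
  classical
  intro A hA
  rw [mu_eq_sum hkn, box_sum_single]
  let T : Finset (Fin n) := {i | A i ≠ Set.univ}
  have hT : T.card < k := by
    by_contra! h
    obtain ⟨i, hi, hAi⟩ := exists_mem_eq_univ_of_le_card hA h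
    exact (Finset.mem_filter.1 hi).2 hAi
  let a : Fin n → ℝ := fun i => if x i ∈ A i then 1 else 0
  let b : Fin n → ℝ := fun i => if y i ∈ A i then 1 else 0
  -- On the vertices of the cube, the indicator of the box is a polynomial in the indicators of
  -- `i ∈ F`, of degree at most the number of its nontrivial sides.
  have hind : ∀ F : Finset (Fin n), ∀ c : ℝ, (Set.univ.pi A).indicator (fun _ => c)
      (F.piecewise x y) =
      ∑ U ∈ T.powerset, (∏ i ∈ U, (a i - b i)) * (∏ i ∈ T \ U, b i) * if U ⊆ F then c else 0 := by
    intro F c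
    have h1 : (Set.univ.pi A).indicator (fun _ => c) (F.piecewise x y) =
        (∏ i ∈ T, ((a i - b i) * (if i ∈ F then 1 else 0) + b i)) * c := by
      have h2 : ∀ i, (a i - b i) * (if i ∈ F then 1 else 0) + b i =
          if F.piecewise x y i ∈ A i then 1 else 0 := by
        intro i
        by_cases hi : i ∈ F <;> simp [hi, a, b]
      simp only [h2, Finset.prod_ite_zero, Finset.prod_const_one]
      by_cases h : F.piecewise x y ∈ Set.univ.pi A
      · rw [Set.indicator_of_mem h, if_pos fun i _ => h i (Set.mem_univ _), one_mul]
      · rw [Set.indicator_of_notMem h, if_neg, zero_mul]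
        intro h3
        refine h fun i _ => ?_
        by_cases hi : i ∈ T
        · exact h3 i hi
        · have : A i = Set.univ := by simpa [T] using hi
          simp [this]
    rw [h1, Finset.prod_add, Finset.sum_mul]
    refine Finset.sum_congr rfl fun U _ => ?_
    rw [Finset.prod_mul_distrib, Finset.prod_ite_zero, Finset.prod_const_one]
    by_cases hU : U ⊆ F
    · rw [if_pos hU, if_pos fun i hi => hU hi]; ring
    · rw [if_neg hU, if_neg fun h => hU fun i hi => h i hi]; ring
  simp only [hind]
  rw [Finset.sum_comm]
  refine Finset.sum_eq_zero fun U hU => ?_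
  rw [← Finset.mul_sum, sum_muCoeff_superset hkn, mul_zero]
  exact (Finset.card_le_card (Finset.mem_powerset.1 hU)).trans_lt hT

lemma kernelK_eq_sum (hkn : k < n) (I : (∀ i, X i) → (∀ i, X i) → ℝ) (x₀ x y : ∀ i, X i) :
    kernelK k I x₀ x y = ∑ F : Finset (Fin n), ∑ G : Finset (Fin n),
      muCoeff n k F * muCoeff n k G *
        ((-1 : ℝ) ^ k * I (F.piecewise x x₀) (G.piecewise y x₀)) := by
  rw [kernelK, mu_eq_sum hkn, mu_eq_sum hkn, discreteIntegral₂_sum_single]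

lemma isSymm_kernelK (hkn : k < n) (hI : IsCompleteNSymmetric I) (x₀ x y : ∀ i, X i) :
    kernelK k I x₀ x y = kernelK k I x₀ y x := by
  rw [kernelK_eq_sum hkn, kernelK_eq_sum hkn, Finset.sum_comm]
  refine Finset.sum_congr rfl fun F _ => Finset.sum_congr rfl fun G _ => ?_
  rw [hI.symm, mul_comm (muCoeff n k G)]

lemma isPD_kernelK (hkn : k < n) (hI : IsCompleteNSymmetric I) (hPDI : IsPDI k I)
    (x₀ : ∀ i, X i) : IsPD (kernelK k I x₀) := by
  refine ⟨isSymm_kernelK hkn hI x₀, fun c => ?_⟩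
  · have h : discreteIntegral₂ (kernelK k I x₀) c c =
        discreteIntegral₂ (fun u v => (-1 : ℝ) ^ k * I u v) (c.sum fun x a => a • mu k x x₀)
          (c.sum fun x a => a • mu k x x₀) := by
      rw [← discreteBilin_apply (fun u v => (-1 : ℝ) ^ k * I u v)]
      simp only [Finsupp.sum, map_sum, LinearMap.sum_apply, map_smul, LinearMap.smul_apply,
        smul_eq_mul, discreteBilin_apply, discreteIntegral₂]
      refine Finset.sum_congr rfl fun u _ => ?_
      rw [Finset.mul_sum]
      refine Finset.sum_congr rfl fun v _ => ?_
      rw [(isSymm_kernelK hkn hI x₀) u v, kernelK, discreteIntegral₂]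
      simp only [Finsupp.sum]
      ring
    rw [h]
    refine hPDI.2 _ (mem_discreteSubmodule.1 (Submodule.sum_mem _ fun x _ =>
      Submodule.smul_mem _ _ (mem_discreteSubmodule.2 (discreteM_mu hkn x x₀))))

end BasePoint

end PDI

/-! ### Continuous functions of concentrated random points and Radon measures -/

namespace PDI

section ConcentratedPoints

variable {ι : Type*} {X : ι → Type*} [∀ i, TopologicalSpace (X i)]
  {Ω : Type*} [MeasurableSpace Ω]

/-- A random point of a product of topological spaces whose coordinates are Borel measurable and
concentrated on `σ`-compact sets. No σ-algebra on the product is involved, so the notion makes sense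
both for the Borel σ-algebra of the product and for the product of the Borel σ-algebras, which may
be smaller. -/
structure IsConcentrated (ν : Measure Ω) (g : Ω → ∀ i, X i) : Prop where
  measurable : ∀ i, Measurable[_, borel (X i)] fun ω => g ω i
  concentrated : ∀ i, ∃ A : Set (X i), IsSigmaCompact A ∧ ∀ᵐ ω ∂ν, g ω i ∈ A

lemma IsConcentrated.comp {Ω' : Type*} [MeasurableSpace Ω'] {ν : Measure Ω} {ν' : Measure Ω'}
    {g : Ω → ∀ i, X i} (hg : IsConcentrated ν g) {φ : Ω' → Ω}
    (hφ : Measure.QuasiMeasurePreserving φ ν' ν) : IsConcentrated ν' fun ω => g (φ ω) where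
  measurable i := @Measurable.comp _ _ _ _ _ (borel (X i)) _ _ (hg.measurable i) hφ.measurable
  concentrated i := by
    obtain ⟨A, hA, h⟩ := hg.concentrated i
    exact ⟨A, hA, hφ.ae h⟩

lemma isConcentrated_const (ν : Measure Ω) (z : ∀ i, X i) : IsConcentrated ν fun _ => z where
  measurable i := @measurable_const _ _ (borel (X i)) _ _
  concentrated i := ⟨{z i}, isCompact_singleton.isSigmaCompact, by simp⟩

/-- Points whose coordinates are taken from concentrated points are concentrated. -/
lemma IsConcentrated.of_coord {κ : Type*} {Y : κ → Type*}
    [∀ j, TopologicalSpace (Y j)] {ν : Measure Ω} {h : Ω → ∀ j, Y j}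
    (H : ∀ j, ∃ g : Ω → ∀ j, Y j, IsConcentrated ν g ∧ ∀ ω, h ω j = g ω j) :
    IsConcentrated ν h where
  measurable j := by
    obtain ⟨g, hg, e⟩ := H j
    simpa only [e] using hg.measurable j
  concentrated j := by
    obtain ⟨g, hg, e⟩ := H j
    simpa only [e] using hg.concentrated j

lemma IsConcentrated.piecewise [DecidableEq ι] {ν : Measure Ω} {g h : Ω → ∀ i, X i}
    (hg : IsConcentrated ν g) (hh : IsConcentrated ν h) (F : Finset ι) :
    IsConcentrated ν fun ω => F.piecewise (g ω) (h ω) :=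
  .of_coord fun i => by
    by_cases hi : i ∈ F
    · exact ⟨g, hg, fun ω => by simp [hi]⟩
    · exact ⟨h, hh, fun ω => by simp [hi]⟩

/-- A compact subset of an open set of a finite product of spaces is contained in a set of the
product σ-algebra that is contained in the open set. -/
lemma exists_measurableSet_between [Fintype ι] [∀ i, MeasurableSpace (X i)] [∀ i, BorelSpace (X i)]
    {K U : Set (∀ i, X i)} (hK : IsCompact K) (hU : IsOpen U) (hKU : K ⊆ U) :
    ∃ W, MeasurableSet W ∧ K ⊆ W ∧ W ⊆ U := by
  have key : ∃ W, MeasurableSet W ∧ K ∩ U ⊆ W ∧ W ⊆ U := by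
    refine hK.induction_on (p := fun s => ∃ W, MeasurableSet W ∧ s ∩ U ⊆ W ∧ W ⊆ U)
      ⟨∅, MeasurableSet.empty, by simp, by simp⟩ ?_ ?_ ?_
    · rintro s t hst ⟨W, h1, h2, h3⟩
      exact ⟨W, h1, (Set.inter_subset_inter_left _ hst).trans h2, h3⟩
    · rintro s t ⟨W, h1, h2, h3⟩ ⟨W', h1', h2', h3'⟩
      refine ⟨W ∪ W', h1.union h1', ?_, Set.union_subset h3 h3'⟩
      rw [Set.union_inter_distrib_right]
      exact Set.union_subset_union h2 h2'
    · intro x hx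
      obtain ⟨u, hu, huU⟩ := isOpen_pi_iff'.1 hU x (hKU hx)
      refine ⟨Set.univ.pi u, mem_nhdsWithin_of_mem_nhds
        ((isOpen_set_pi Set.finite_univ fun i _ => (hu i).1).mem_nhds fun i _ => (hu i).2),
        Set.univ.pi u, MeasurableSet.univ_pi fun i => (hu i).1.measurableSet,
        Set.inter_subset_left, huU⟩
  obtain ⟨W, h1, h2, h3⟩ := key
  exact ⟨W, h1, fun x hx => h2 ⟨hx, hKU hx⟩, h3⟩

/-- A continuous function on a finite product, restricted to a product of `σ`-compact sets, is
measurable for the product σ-algebra. -/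
lemma measurable_indicator_pi_of_isSigmaCompact [Fintype ι] [∀ i, T2Space (X i)]
    [∀ i, MeasurableSpace (X i)] [∀ i, BorelSpace (X i)] {A : ∀ i, Set (X i)}
    (hA : ∀ i, IsSigmaCompact (A i)) {f : (∀ i, X i) → ℝ} (hf : Continuous f) :
    Measurable ((Set.univ.pi A).indicator f) := by
  choose C hC hCA using hA
  have hbox : ∀ m : ι → ℕ, IsCompact (Set.univ.pi fun i => C i (m i)) := fun m =>
    isCompact_univ_pi fun i => hC i (m i)
  have hboxm : ∀ m : ι → ℕ, MeasurableSet (Set.univ.pi fun i => C i (m i)) := fun m =>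
    MeasurableSet.univ_pi fun i => (hC i (m i)).isClosed.measurableSet
  have hpi : Set.univ.pi A = ⋃ m : ι → ℕ, Set.univ.pi fun i => C i (m i) := by
    rw [Set.iUnion_univ_pi]
    simp only [hCA]
  have hAm : MeasurableSet (Set.univ.pi A) := by
    rw [hpi]; exact MeasurableSet.iUnion hboxm
  have hgt : ∀ a : ℝ, MeasurableSet (Set.univ.pi A ∩ {x | a < f x}) := by
    intro a
    rw [hpi, Set.iUnion_inter]
    refine MeasurableSet.iUnion fun m => ?_
    set D := Set.univ.pi fun i => C i (m i) with hD
    have hW : ∀ j : ℕ, ∃ W, MeasurableSet W ∧ D ∩ {x | a + 1 / ((j : ℝ) + 1) ≤ f x} ⊆ W ∧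
        W ⊆ {x | a < f x} := fun j =>
      exists_measurableSet_between
        ((hbox m).inter_right (isClosed_le continuous_const hf)) (isOpen_lt continuous_const hf)
        fun x hx => lt_of_lt_of_le (lt_add_of_pos_right a (by positivity)) hx.2
    choose W hWm hW1 hW2 using hW
    have : D ∩ {x | a < f x} = D ∩ ⋃ j, W j := by
      ext x
      simp only [Set.mem_inter_iff, Set.mem_iUnion]
      refine and_congr_right fun hx => ⟨fun h => ?_, fun ⟨j, h⟩ => hW2 j h⟩
      obtain ⟨j, hj⟩ := exists_nat_one_div_lt (show (0 : ℝ) < f x - a from sub_pos.2 h)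
      exact ⟨j, hW1 j ⟨hx, by simp only [Set.mem_ofPred_eq]; linarith⟩⟩
    rw [this]
    exact (hboxm m).inter (MeasurableSet.iUnion hWm)
  refine measurable_of_Ioi fun a => ?_
  have : (Set.univ.pi A).indicator f ⁻¹' Set.Ioi a =
      (Set.univ.pi A ∩ {x | a < f x}) ∪ ((Set.univ.pi A)ᶜ ∩ {_x | a < 0}) := by
    ext x
    by_cases hx : x ∈ Set.univ.pi A
    · simp only [Set.mem_preimage, Set.indicator_of_mem hx, Set.mem_Ioi, Set.mem_union,
        Set.mem_inter_iff, hx, true_and, Set.mem_ofPred_eq, Set.mem_compl_iff, not_true, false_and,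
        or_false]
    · simp only [Set.mem_preimage, Set.indicator_of_notMem hx, Set.mem_Ioi, Set.mem_union,
        Set.mem_inter_iff, hx, false_and, Set.mem_ofPred_eq, Set.mem_compl_iff, not_false_eq_true,
        true_and, false_or]
  rw [this]
  exact (hgt a).union (hAm.compl.inter (MeasurableSet.const _))

/-- The values of a continuous function at concentrated points are, almost surely, values of a
function that is measurable for the product of the Borel σ-algebras. -/
lemma exists_measurable_ae_eq [Fintype ι] [∀ i, T2Space (X i)] {Ω' : Type*} [MeasurableSpace Ω']
    {ν : Measure Ω} {g : Ω → ∀ i, X i} (hg : IsConcentrated ν g)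
    {ν' : Measure Ω'} {g' : Ω' → ∀ i, X i} (hg' : IsConcentrated ν' g')
    {f : (∀ i, X i) → ℝ} (hf : Continuous f) :
    ∃ h : (∀ i, X i) → ℝ, Measurable[@MeasurableSpace.pi ι X fun i => borel (X i)] h ∧
      (fun ω => f (g ω)) =ᵐ[ν] (fun ω => h (g ω)) ∧
      (fun ω => f (g' ω)) =ᵐ[ν'] (fun ω => h (g' ω)) := by
  let : ∀ i, MeasurableSpace (X i) := fun i => borel (X i)
  have : ∀ i, BorelSpace (X i) := fun i => ⟨rfl⟩
  choose A hA hAg using hg.concentrated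
  choose A' hA' hAg' using hg'.concentrated
  have hU : ∀ i, IsSigmaCompact (A i ∪ A' i) := by
    intro i
    rw [Set.union_eq_iUnion]
    exact isSigmaCompact_iUnion _ fun b => by cases b <;> simp [hA, hA']
  refine ⟨(Set.univ.pi fun i => A i ∪ A' i).indicator f,
    measurable_indicator_pi_of_isSigmaCompact hU hf, ?_, ?_⟩
  · filter_upwards [ae_all_iff.2 hAg] with ω hω
    exact (Set.indicator_of_mem (s := Set.univ.pi fun i => A i ∪ A' i)
      (fun i _ => Or.inl (hω i)) f).symm
  · filter_upwards [ae_all_iff.2 hAg'] with ω hω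
    exact (Set.indicator_of_mem (s := Set.univ.pi fun i => A i ∪ A' i)
      (fun i _ => Or.inr (hω i)) f).symm

lemma IsConcentrated.aestronglyMeasurable [Fintype ι] [∀ i, T2Space (X i)] {ν : Measure Ω}
    {g : Ω → ∀ i, X i} (hg : IsConcentrated ν g) {f : (∀ i, X i) → ℝ} (hf : Continuous f) :
    AEStronglyMeasurable (fun ω => f (g ω)) ν := by
  obtain ⟨h, hm, he, -⟩ := exists_measurable_ae_eq hg hg hf
  let : ∀ i, MeasurableSpace (X i) := fun i => borel (X i)
  exact (AEMeasurable.congr (hm.comp (measurable_pi_iff.2 hg.measurable)).aemeasurable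
    he.symm).aestronglyMeasurable

/-- Two concentrated random points with the same box probabilities give the same integrals of
continuous functions. -/
lemma integrable_and_integral_eq_of_box_eq [Fintype ι] [∀ i, T2Space (X i)]
    {Ω' : Type*} [MeasurableSpace Ω']
    {ν : Measure Ω} [IsProbabilityMeasure ν] {g : Ω → ∀ i, X i} (hg : IsConcentrated ν g)
    {ν' : Measure Ω'} [IsProbabilityMeasure ν'] {g' : Ω' → ∀ i, X i} (hg' : IsConcentrated ν' g')
    (hbox : ∀ A : ∀ i, Set (X i), (∀ i, MeasurableSet[borel (X i)] (A i)) →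
      ν {ω | ∀ i, g ω i ∈ A i} = ν' {ω | ∀ i, g' ω i ∈ A i})
    {f : (∀ i, X i) → ℝ} (hf : Continuous f) :
    (Integrable (fun ω => f (g ω)) ν → Integrable (fun ω => f (g' ω)) ν') ∧
      ∫ ω, f (g ω) ∂ν = ∫ ω, f (g' ω) ∂ν' := by
  obtain ⟨h, hm, he, he'⟩ := exists_measurable_ae_eq hg hg' hf
  let : ∀ i, MeasurableSpace (X i) := fun i => borel (X i)
  have m : Measurable g := measurable_pi_iff.2 hg.measurable
  have m' : Measurable g' := measurable_pi_iff.2 hg'.measurable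
  have hlaw : ν.map g = ν'.map g' := by
    have : IsProbabilityMeasure (ν.map g) := Measure.isProbabilityMeasure_map m.aemeasurable
    have : IsProbabilityMeasure (ν'.map g') := Measure.isProbabilityMeasure_map m'.aemeasurable
    refine ext_of_generate_finite _ generateFrom_pi.symm isPiSystem_pi ?_ (by simp)
    rintro _ ⟨A, hA, rfl⟩
    have hA' : MeasurableSet (Set.univ.pi A) :=
      MeasurableSet.univ_pi fun i => hA i (Set.mem_univ i)
    rw [Measure.map_apply m hA', Measure.map_apply m' hA']
    simpa [Set.preimage, Set.mem_univ_pi] using hbox A fun i => hA i (Set.mem_univ i)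
  refine ⟨fun hint => ?_, ?_⟩
  · rw [integrable_congr he']
    rw [integrable_congr he] at hint
    have h1 : Integrable h (ν.map g) :=
      (integrable_map_measure hm.aestronglyMeasurable m.aemeasurable).2 hint
    rw [hlaw] at h1
    exact (integrable_map_measure hm.aestronglyMeasurable m'.aemeasurable).1 h1
  · rw [integral_congr_ae he, integral_congr_ae he', ← integral_map m.aemeasurable
      hm.aestronglyMeasurable, ← integral_map m'.aemeasurable hm.aestronglyMeasurable, hlaw]

end ConcentratedPoints

section Radon

variable {S : Type*} [TopologicalSpace S] [MeasurableSpace S]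

lemma IsRadon.exists_isCompact_diff_lt [T2Space S] [BorelSpace S] {μ : Measure S}
    [IsFiniteMeasure μ] (h : IsRadon μ) {E : Set S} (hE : MeasurableSet E) {ε : ENNReal}
    (hε : ε ≠ 0) : ∃ K ⊆ E, IsCompact K ∧ μ (E \ K) < ε := by
  rcases eq_or_ne (μ E) 0 with h0 | h0
  · exact ⟨∅, Set.empty_subset _, isCompact_empty, by simpa [h0] using hε.bot_lt⟩
  have hlt : μ E - ε < μ E := ENNReal.sub_lt_self (measure_ne_top _ _) h0 hε
  rw [h.inner_regular E hE] at hlt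
  obtain ⟨K, hK⟩ := lt_iSup_iff.1 hlt
  obtain ⟨⟨hKc, hKE⟩, hK⟩ := lt_iSup_iff.1 hK
  refine ⟨K, hKE, hKc, ?_⟩
  rw [← h.inner_regular E hE] at hK
  rw [measure_sdiff hKE hKc.isClosed.measurableSet.nullMeasurableSet (measure_ne_top _ _)]
  have h2 : μ E < μ K + ε := ENNReal.lt_add_of_sub_lt_right (Or.inl (measure_ne_top _ _)) hK
  exact ENNReal.sub_lt_of_lt_add (measure_mono hKE) (by rwa [add_comm])

lemma isRadon_of_forall_exists_diff_lt [T2Space S] {μ : Measure S} [IsFiniteMeasure μ]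
    (h : ∀ E, MeasurableSet E → ∀ ε : ENNReal, ε ≠ 0 → ∃ K ⊆ E, IsCompact K ∧ μ (E \ K) < ε) :
    IsRadon μ where
  finite_on_compacts K _ := measure_lt_top μ K
  inner_regular E hE := by
    refine le_antisymm ?_ (iSup₂_le fun K hK => measure_mono hK.2)
    refine ENNReal.le_of_forall_pos_le_add fun ε hε _ => ?_
    obtain ⟨K, hKE, hKc, hlt⟩ := h E hE ε (by exact_mod_cast hε.ne')
    calc μ E = μ (E \ K ∪ K) := by rw [Set.sdiff_union_of_subset hKE]
      _ ≤ μ (E \ K) + μ K := measure_union_le _ _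
      _ ≤ ε + ⨆ K ∈ {K | IsCompact K ∧ K ⊆ E}, μ K :=
        add_le_add hlt.le (le_iSup₂ (f := fun K _ => μ K) K ⟨hKc, hKE⟩)
      _ = _ := add_comm _ _
  outer_regular E hE := by
    refine le_antisymm (le_iInf₂ fun U hU => measure_mono hU.2) ?_
    refine ENNReal.le_of_forall_pos_le_add fun ε hε _ => ?_
    obtain ⟨K, hKE, hKc, hlt⟩ := h Eᶜ hE.compl ε (by exact_mod_cast hε.ne')
    have hEK : E ⊆ Kᶜ := fun x hx hxK => hKE hxK hx
    calc ⨅ U ∈ {U | IsOpen U ∧ E ⊆ U}, μ U ≤ μ Kᶜ :=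
        iInf₂_le (f := fun U _ => μ U) Kᶜ ⟨hKc.isClosed.isOpen_compl, hEK⟩
      _ ≤ μ (E ∪ Eᶜ \ K) := measure_mono fun x hx => by
        by_cases hxE : x ∈ E
        · exact Or.inl hxE
        · exact Or.inr ⟨hxE, hx⟩
      _ ≤ μ E + μ (Eᶜ \ K) := measure_union_le _ _
      _ ≤ μ E + ε := add_le_add le_rfl hlt.le

lemma IsRadon.mono [T2Space S] [BorelSpace S] {μ ν : Measure S} [IsFiniteMeasure μ] (h : IsRadon μ)
    (hle : ν ≤ μ) : IsRadon ν := by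
  have : IsFiniteMeasure ν := isFiniteMeasure_of_le μ hle
  refine isRadon_of_forall_exists_diff_lt fun E hE ε hε => ?_
  obtain ⟨K, hKE, hKc, hlt⟩ := h.exists_isCompact_diff_lt hE hε
  exact ⟨K, hKE, hKc, (hle _).trans_lt hlt⟩

lemma IsRadon.add [T2Space S] [BorelSpace S] {μ ν : Measure S} [IsFiniteMeasure μ]
    [IsFiniteMeasure ν] (hμ : IsRadon μ) (hν : IsRadon ν) : IsRadon (μ + ν) := by
  refine isRadon_of_forall_exists_diff_lt fun E hE ε hε => ?_
  obtain ⟨K, hKE, hKc, hlt⟩ := hμ.exists_isCompact_diff_lt hE (ENNReal.half_pos hε).ne'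
  obtain ⟨L, hLE, hLc, hlt'⟩ := hν.exists_isCompact_diff_lt hE (ENNReal.half_pos hε).ne'
  refine ⟨K ∪ L, Set.union_subset hKE hLE, hKc.union hLc, ?_⟩
  rw [Measure.add_apply, ← ENNReal.add_halves ε]
  exact ENNReal.add_lt_add
    ((measure_mono (Set.sdiff_subset_sdiff_right Set.subset_union_left)).trans_lt hlt)
    ((measure_mono (Set.sdiff_subset_sdiff_right Set.subset_union_right)).trans_lt hlt')

lemma IsRadon.exists_isSigmaCompact [T2Space S] [BorelSpace S] {μ : Measure S} [IsFiniteMeasure μ]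
    (h : IsRadon μ) : ∃ A : Set S, IsSigmaCompact A ∧ ∀ᵐ x ∂μ, x ∈ A := by
  have hK : ∀ m : ℕ, ∃ K : Set S, IsCompact K ∧ μ Kᶜ < ((m : ENNReal) + 1)⁻¹ := by
    intro m
    obtain ⟨K, -, hKc, hlt⟩ := h.exists_isCompact_diff_lt MeasurableSet.univ
      (ε := ((m : ENNReal) + 1)⁻¹) (by simp)
    exact ⟨K, hKc, by rwa [Set.compl_eq_univ_sdiff]⟩
  choose K hKc hlt using hK
  refine ⟨⋃ m, K m, isSigmaCompact_iUnion_of_isCompact _ hKc, ?_⟩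
  rw [ae_iff]
  refine le_antisymm (ENNReal.le_of_forall_pos_le_add fun ε hε _ => ?_) bot_le
  obtain ⟨m, hm⟩ := ENNReal.exists_inv_nat_lt (a := (ε : ENNReal)) (by exact_mod_cast hε.ne')
  calc μ {x | x ∉ ⋃ m, K m} ≤ μ (K m)ᶜ :=
        measure_mono fun x hx hxm => hx (Set.mem_iUnion.2 ⟨m, hxm⟩)
    _ ≤ ((m : ENNReal) + 1)⁻¹ := (hlt m).le
    _ ≤ (m : ENNReal)⁻¹ := ENNReal.inv_le_inv.2 le_self_add
    _ ≤ 0 + ε := by rw [zero_add]; exact hm.le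

end Radon

lemma measurable_eval_borel {ι : Type*} {X : ι → Type*} [∀ i, TopologicalSpace (X i)]
    [MeasurableSpace (∀ i, X i)] [BorelSpace (∀ i, X i)] (i : ι) :
    Measurable[_, borel (X i)] fun x : ∀ i, X i => x i := by
  let : MeasurableSpace (X i) := borel (X i)
  have : BorelSpace (X i) := ⟨rfl⟩
  exact (continuous_apply i).measurable

lemma IsRadon.isConcentrated {ι : Type*} {X : ι → Type*}
    [∀ i, TopologicalSpace (X i)] [∀ i, T2Space (X i)]
    [MeasurableSpace (∀ i, X i)] [BorelSpace (∀ i, X i)] {μ : Measure (∀ i, X i)}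
    [IsFiniteMeasure μ] (h : IsRadon μ) : IsConcentrated μ fun x => x where
  measurable := measurable_eval_borel
  concentrated i := by
    obtain ⟨A, hA, hx⟩ := h.exists_isSigmaCompact
    refine ⟨(fun x => x i) '' A, hA.image (continuous_apply i), ?_⟩
    filter_upwards [hx] with x hx
    exact Set.mem_image_of_mem _ hx

end PDI

/-! ### Marginals and independent blocks -/

namespace PDI

section Marginals

lemma continuous_piecewise_left {ι : Type*} [DecidableEq ι] {X : ι → Type*}
    [∀ i, TopologicalSpace (X i)] (F : Finset ι) (w : ∀ i, X i) :
    Continuous fun x : ∀ i, X i => F.piecewise x w := by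
  refine continuous_pi fun i => ?_
  by_cases hi : i ∈ F
  · simpa only [Finset.piecewise_eq_of_mem _ _ _ hi] using continuous_apply i
  · simpa only [Finset.piecewise_eq_of_notMem _ _ _ hi] using continuous_const

lemma diff_apply {n : ℕ} {X : Fin n → Type*} [MeasurableSpace (∀ i, X i)]
    (P Q : ProbabilityMeasure (∀ i, X i)) {E : Set (∀ i, X i)} (hE : MeasurableSet E) :
    diff P Q E = (P : Measure (∀ i, X i)).real E - (Q : Measure (∀ i, X i)).real E := by
  rw [diff, sub_apply, Measure.toSignedMeasure_apply_measurable hE,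
    Measure.toSignedMeasure_apply_measurable hE]

variable {n k : ℕ} {X : Fin n → Type*} [∀ i, TopologicalSpace (X i)]
  [MeasurableSpace (∀ i, X i)]

/-- The cylinder over the sides `A i`, `i ∈ F`. -/
def cylinder (F : Finset (Fin n)) (A : ∀ i, Set (X i)) : Set (∀ i, X i) := {x | ∀ i ∈ F, x i ∈ A i}

/-- The marginals of the two measures on fewer than `k` coordinates agree on Borel boxes. -/
def MarginalsAgree (k : ℕ) (μ ν : Measure (∀ i, X i)) : Prop :=
  ∀ (F : Finset (Fin n)), F.card < k → ∀ A : ∀ i, Set (X i),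
    (∀ i, MeasurableSet[borel (X i)] (A i)) → μ (cylinder F A) = ν (cylinder F A)

lemma MarginalsAgree.symm {μ ν : Measure (∀ i, X i)} (h : MarginalsAgree k μ ν) :
    MarginalsAgree k ν μ := fun F hF A hA => (h F hF A hA).symm

lemma MarginalsAgree.trans {μ ν ρ : Measure (∀ i, X i)} (h : MarginalsAgree k μ ν)
    (h' : MarginalsAgree k ν ρ) : MarginalsAgree k μ ρ :=
  fun F hF A hA => (h F hF A hA).trans (h' F hF A hA)

variable [BorelSpace (∀ i, X i)]

lemma measurableSet_cylinder (F : Finset (Fin n)) {A : ∀ i, Set (X i)}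
    (hA : ∀ i, MeasurableSet[borel (X i)] (A i)) : MeasurableSet (cylinder F A) := by
  have : cylinder F A = ⋂ i ∈ F, (fun x => x i) ⁻¹' A i := by ext; simp [cylinder]
  rw [this]
  exact Finset.measurableSet_biInter F fun i _ => measurable_eval_borel i (hA i)

lemma RadonM.marginalsAgree {P Q : ProbabilityMeasure (∀ i, X i)} (h : RadonM k (diff P Q)) :
    MarginalsAgree k (P : Measure (∀ i, X i)) Q := by
  classical
  intro F hF A hA
  let B : ∀ i, Set (X i) := fun i => if i ∈ F then A i else Set.univ
  have hBm : ∀ i, MeasurableSet[borel (X i)] (B i) := by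
    intro i
    by_cases hi : i ∈ F
    · simpa [B, hi] using hA i
    · simp only [B, hi, if_false]
      exact @MeasurableSet.univ _ (borel (X i))
  have hB : Set.univ.pi B = cylinder F A := by
    ext x
    simp only [Set.mem_univ_pi, cylinder, Set.mem_ofPred_eq]
    refine forall_congr' fun i => ?_
    by_cases hi : i ∈ F <;> simp [B, hi]
  have hcard : Fᶜ.card ≤ {i | B i = Set.univ}.ncard := by
    rw [← Set.ncard_coe_finset]
    exact Set.ncard_le_ncard (fun i hi => by
      have : i ∉ F := by simpa using hi
      simp [B, this]) (Set.toFinite _)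
  rw [Finset.card_compl, Fintype.card_fin] at hcard
  have h0 := h.2 B hBm (by omega)
  rw [hB, diff_apply P Q (measurableSet_cylinder F hA), sub_eq_zero] at h0
  exact (ENNReal.toReal_eq_toReal_iff' (measure_ne_top _ _) (measure_ne_top _ _)).1 h0

lemma MarginalsAgree.radonM [∀ i, T2Space (X i)] {P Q : ProbabilityMeasure (∀ i, X i)}
    (h : MarginalsAgree k (P : Measure (∀ i, X i)) Q) (hP : IsRadon (P : Measure (∀ i, X i)))
    (hQ : IsRadon (Q : Measure (∀ i, X i))) : RadonM k (diff P Q) := by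
  classical
  refine ⟨(hP.add hQ).mono ?_, fun A hA hcard => ?_⟩
  · refine VectorMeasure.variation_sub_le.trans (le_of_eq ?_)
    rw [Measure.variation_toSignedMeasure, Measure.variation_toSignedMeasure]
  · let F : Finset (Fin n) := {i | A i ≠ Set.univ}
    have hF : F.card < k := by
      by_contra! h
      obtain ⟨i, hi, hAi⟩ := exists_mem_eq_univ_of_le_card hcard h
      exact (Finset.mem_filter.1 hi).2 hAi
    have hB : Set.univ.pi A = cylinder F A := by
      ext x
      simp only [Set.mem_univ_pi, cylinder, Set.mem_ofPred_eq]
      refine forall_congr' fun i => ?_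
      by_cases hi : A i = Set.univ <;> simp [F, hi]
    rw [hB, diff_apply P Q (measurableSet_cylinder F hA), Measure.real, Measure.real, h F hF A hA,
      sub_self]

/-- The integral of a continuous function of fewer than `k` coordinates depends only on the
marginals of that order. -/
lemma MarginalsAgree.integral_piecewise_eq [∀ i, T2Space (X i)] {μ ν : Measure (∀ i, X i)}
    [IsProbabilityMeasure μ] [IsProbabilityMeasure ν] (h : MarginalsAgree k μ ν)
    (hμ : IsRadon μ) (hν : IsRadon ν) {F : Finset (Fin n)} (hF : F.card < k) (z : ∀ i, X i)
    {f : (∀ i, X i) → ℝ} (hf : Continuous f) :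
    ∫ x, f (F.piecewise x z) ∂μ = ∫ x, f (F.piecewise x z) ∂ν := by
  classical
  refine (integrable_and_integral_eq_of_box_eq
    (hμ.isConcentrated.piecewise (isConcentrated_const μ z) F)
    (hν.isConcentrated.piecewise (isConcentrated_const ν z) F) (fun A hA => ?_) hf).2
  have hset : {x : ∀ i, X i | ∀ i, F.piecewise x z i ∈ A i} =
      if ∀ i ∉ F, z i ∈ A i then cylinder F A else ∅ := by
    ext x
    split_ifs with hz
    · simp only [cylinder, Set.mem_ofPred_eq]
      refine forall_congr' fun i => ?_
      by_cases hi : i ∈ F <;> simp [hi]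
      exact hz i hi
    · simp only [Set.mem_ofPred_eq, Set.mem_empty_iff_false, iff_false]
      intro hx
      exact hz fun i hi => by simpa [hi] using hx i
  rw [hset]
  split_ifs
  · exact h F hF A hA
  · simp

end Marginals

section Blocks

variable {n k : ℕ} {X : Fin n → Type*}

/-- The point whose coordinates in each block of the partition are those of the point chosen for
that block. -/
def blockPoint (π : Finpartition (Finset.univ : Finset (Fin n))) (u : π.parts → ∀ i, X i) :
    ∀ i, X i :=
  fun i => u ⟨π.part i, π.part_mem.2 (Finset.mem_univ i)⟩ i

variable [MeasurableSpace (∀ i, X i)]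

open Classical in
lemma pi_blockPoint_box {Q : Measure (∀ i, X i)} [IsProbabilityMeasure Q]
    (π : Finpartition (Finset.univ : Finset (Fin n))) (D : Finset (Fin n)) (w : ∀ i, X i)
    (A : ∀ i, Set (X i)) :
    (Measure.pi fun _ : π.parts => Q) {u | ∀ i, D.piecewise (blockPoint π u) w i ∈ A i} =
      if ∀ i ∉ D, w i ∈ A i then ∏ B ∈ π.parts, Q (cylinder (D ∩ B) A) else 0 := by
  split_ifs with hw
  · have hset : {u : π.parts → ∀ i, X i | ∀ i, D.piecewise (blockPoint π u) w i ∈ A i} =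
        Set.univ.pi fun B : π.parts => cylinder (D ∩ B) A := by
      ext u
      simp only [Set.mem_ofPred_eq, Set.mem_univ_pi, cylinder, Finset.mem_inter, Subtype.forall]
      constructor
      · rintro h B hB i ⟨hiD, hiB⟩
        have := h i
        rw [Finset.piecewise_eq_of_mem _ _ _ hiD, blockPoint] at this
        have hpart : π.part i = B := π.part_eq_of_mem hB hiB
        subst hpart
        exact this
      · intro h i
        by_cases hi : i ∈ D
        · rw [Finset.piecewise_eq_of_mem _ _ _ hi]
          exact h _ _ i ⟨hi, π.mem_part (Finset.mem_univ i)⟩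
        · rw [Finset.piecewise_eq_of_notMem _ _ _ hi]
          exact hw i hi
    rw [hset, Measure.pi_pi, Finset.prod_coe_sort π.parts fun B => Q (cylinder (D ∩ B) A)]
  · have hset : {u : π.parts → ∀ i, X i | ∀ i, D.piecewise (blockPoint π u) w i ∈ A i} = ∅ := by
      rw [Set.eq_empty_iff_forall_notMem]
      intro u hu
      exact hw fun i hi => by simpa [hi] using hu i
    rw [hset, measure_empty]

variable [∀ i, TopologicalSpace (X i)]

lemma isConcentrated_blockPoint {Q : Measure (∀ i, X i)} [IsProbabilityMeasure Q]
    (hQ : IsConcentrated Q fun x => x) (π : Finpartition (Finset.univ : Finset (Fin n))) :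
    IsConcentrated (Measure.pi fun _ : π.parts => Q) (blockPoint π) :=
  .of_coord fun i => ⟨_, hQ.comp (Measure.quasiMeasurePreserving_eval (μ := fun _ : π.parts => Q)
    ⟨π.part i, π.part_mem.2 (Finset.mem_univ i)⟩), fun _ => rfl⟩

variable {I : (∀ i, X i) → (∀ i, X i) → ℝ}

/-- The partition of the coordinates into a single block gives integrability with respect to the
measure itself. -/
lemma integrable_of_mem_integrableProbabilities [BorelSpace (∀ i, X i)] (hn : 0 < n)
    (hcont : Continuous fun p : (∀ i, X i) × (∀ i, X i) => I p.1 p.2)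
    {Q : ProbabilityMeasure (∀ i, X i)} (hQ : Q ∈ IntegrableProbabilities I)
    (F : Finset (Fin n)) (w z : ∀ i, X i) :
    Integrable (fun x => I (F.piecewise x w) z) (Q : Measure (∀ i, X i)) := by
  have hne : (Finset.univ : Finset (Fin n)) ≠ ⊥ := by
    rw [Finset.bot_eq_empty]
    exact Finset.nonempty_iff_ne_empty.1 ⟨⟨0, hn⟩, Finset.mem_univ _⟩
  let π := Finpartition.indiscrete hne
  have h := hQ.2 π F w z
  have hB : Finset.univ ∈ π.parts := by simp [π]
  have hpart : ∀ i, π.part i = Finset.univ := fun i => π.part_eq_of_mem hB (Finset.mem_univ i)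
  have heq : (fun u : π.parts → (∀ i, X i) =>
      I (F.piecewise (fun i => u ⟨π.part i, π.part_mem.2 (Finset.mem_univ i)⟩ i) w) z) =
      (fun x => I (F.piecewise x w) z) ∘ Function.eval ⟨Finset.univ, hB⟩ := by
    funext u
    simp only [Function.comp_apply, Function.eval, hpart]
  rw [IntegrablePartition, heq] at h
  have hc : Continuous fun x : ∀ i, X i => I (F.piecewise x w) z := by
    exact hcont.comp ((continuous_piecewise_left F w).prodMk continuous_const)
  exact ((measurePreserving_eval (fun _ : π.parts => (Q : Measure (∀ i, X i)))
    ⟨Finset.univ, hB⟩).integrable_comp hc.measurable.aestronglyMeasurable).1 h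

end Blocks

end PDI

/-! ### Integrability and convexity -/

namespace PDI

section Integrability

variable {n k : ℕ} {X : Fin n → Type*} [∀ i, TopologicalSpace (X i)] [∀ i, T2Space (X i)]
  {I : (∀ i, X i) → (∀ i, X i) → ℝ}

/-- A continuous kernel evaluated at two concentrated random points is measurable, although the
pair of points need not be measurable for the Borel σ-algebra of the product of the two copies of
the space. -/
lemma aestronglyMeasurable_kernel {Ω : Type*} [MeasurableSpace Ω] {ν : Measure Ω}
    (hcont : Continuous fun p : (∀ i, X i) × (∀ i, X i) => I p.1 p.2)
    {g h : Ω → ∀ i, X i} (hg : IsConcentrated ν g) (hh : IsConcentrated ν h) :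
    AEStronglyMeasurable (fun ω => I (g ω) (h ω)) ν := by
  let q : Ω → ∀ j : Bool × Fin n, X j.2 := fun ω j => bif j.1 then g ω j.2 else h ω j.2
  have hq : IsConcentrated ν q :=
    { measurable := by
        rintro ⟨b, i⟩
        cases b
        · exact hh.measurable i
        · exact hg.measurable i
      concentrated := by
        rintro ⟨b, i⟩
        cases b
        · exact hh.concentrated i
        · exact hg.concentrated i }
  have hf : Continuous fun q : ∀ j : Bool × Fin n, X j.2 =>
      I (fun i => q (true, i)) (fun i => q (false, i)) := by
    refine hcont.comp (Continuous.prodMk ?_ ?_)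
    · exact continuous_pi fun i => continuous_apply (true, i)
    · exact continuous_pi fun i => continuous_apply (false, i)
  exact hq.aestronglyMeasurable hf

variable [MeasurableSpace (∀ i, X i)] [BorelSpace (∀ i, X i)]

/-- If two nonempty sets of coordinates have at most `k` elements together, then each has fewer than
`k`, so the marginals on either do not depend on the measure, and the pair of restrictions has the
law of a product of two marginals of a single measure. -/
lemma integrable_prod_piecewise_piecewise (hn : 0 < n)
    (hcont : Continuous fun p : (∀ i, X i) × (∀ i, X i) => I p.1 p.2)
    {P Q : ProbabilityMeasure (∀ i, X i)} (hP : P ∈ IntegrableProbabilities I)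
    (hQ : Q ∈ IntegrableProbabilities I)
    (hPQ : MarginalsAgree k (P : Measure (∀ i, X i)) Q) {F G : Finset (Fin n)}
    (hFG : Disjoint F G) (hcard : F.card + G.card ≤ k) (z w : ∀ i, X i) :
    Integrable (fun p : (∀ i, X i) × (∀ i, X i) => I (F.piecewise p.1 (G.piecewise p.2 z)) w)
      ((P : Measure (∀ i, X i)).prod (Q : Measure (∀ i, X i))) := by
  rcases F.eq_empty_or_nonempty with hF | hF
  · subst hF
    simp only [Finset.piecewise_empty]
    exact (integrable_of_mem_integrableProbabilities hn hcont hQ G z w).comp_snd _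
  rcases G.eq_empty_or_nonempty with hG | hG
  · subst hG
    simp only [Finset.piecewise_empty]
    exact (integrable_of_mem_integrableProbabilities hn hcont hP F z w).comp_fst _
  have hFk : F.card < k := by have := hG.card_pos; omega
  have hGk : G.card < k := by have := hF.card_pos; omega
  have hGF : G ⊆ Fᶜ := fun i hi => by
    rw [Finset.mem_compl]; exact fun h => Finset.disjoint_left.1 hFG h hi
  have hFne : F ≠ ⊥ := Finset.nonempty_iff_ne_empty.1 hF
  have hFcne : Fᶜ ≠ ⊥ := Finset.nonempty_iff_ne_empty.1 (hG.mono hGF)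
  -- The integrability of `P` over the partition `{F, Fᶜ}` is transferred to `P × Q`.
  let π : Finpartition (Finset.univ : Finset (Fin n)) :=
    (Finpartition.indiscrete hFne).extend hFcne disjoint_compl_right
      (by rw [sup_compl_eq_top]; rfl)
  have hparts : π.parts = {Fᶜ, F} := rfl
  have hFFc : Fᶜ ≠ F := by
    intro h
    obtain ⟨i, hi⟩ := hF
    have : i ∈ Fᶜ := by rwa [h]
    exact (Finset.mem_compl.1 this) hi
  have hPc := hP.1.isConcentrated
  have hQc := hQ.1.isConcentrated
  have c1 : IsConcentrated (Measure.pi fun _ : π.parts => (P : Measure (∀ i, X i)))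
      fun u => (F ∪ G).piecewise (blockPoint π u) z :=
    (isConcentrated_blockPoint hPc π).piecewise (isConcentrated_const _ z) _
  have c2 : IsConcentrated ((P : Measure (∀ i, X i)).prod (Q : Measure (∀ i, X i)))
      fun p => F.piecewise p.1 (G.piecewise p.2 z) :=
    (hPc.comp Measure.quasiMeasurePreserving_fst).piecewise
      ((hQc.comp Measure.quasiMeasurePreserving_snd).piecewise (isConcentrated_const _ z) G) F
  refine (integrable_and_integral_eq_of_box_eq c1 c2 (fun A hA => ?_)
    (f := fun x => I x w) (hcont.comp (continuous_id.prodMk continuous_const))).1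
    (hP.2 π (F ∪ G) z w)
  rw [pi_blockPoint_box, hparts, Finset.prod_pair hFFc]
  have e1 : (F ∪ G) ∩ F = F := by ext i; simp
  have e2 : (F ∪ G) ∩ Fᶜ = G := by
    ext i
    have := @hGF i
    simp only [Finset.mem_inter, Finset.mem_union, Finset.mem_compl] at this ⊢
    tauto
  rw [e1, e2]
  split_ifs with hz
  · have hset : {p : (∀ i, X i) × (∀ i, X i) |
        ∀ i, F.piecewise p.1 (G.piecewise p.2 z) i ∈ A i} = cylinder F A ×ˢ cylinder G A := by
      ext p
      simp only [Set.mem_ofPred_eq, Set.mem_prod, cylinder]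
      constructor
      · refine fun h => ⟨fun i hi => by simpa [hi] using h i, fun i hi => ?_⟩
        have hiF : i ∉ F := fun h => Finset.disjoint_left.1 hFG h hi
        simpa [hi, hiF] using h i
      · rintro ⟨h1, h2⟩ i
        by_cases hiF : i ∈ F
        · simpa [hiF] using h1 i hiF
        · by_cases hiG : i ∈ G
          · simpa [hiF, hiG] using h2 i hiG
          · simpa [hiF, hiG] using hz i (by simp [hiF, hiG])
    rw [hset, Measure.prod_prod, hPQ G hGk A hA, mul_comm]
  · have hset : {p : (∀ i, X i) × (∀ i, X i) |
        ∀ i, F.piecewise p.1 (G.piecewise p.2 z) i ∈ A i} = ∅ := by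
      rw [Set.eq_empty_iff_forall_notMem]
      refine fun p hp => hz fun i hi => ?_
      simp only [Finset.mem_union, not_or] at hi
      simpa [hi.1, hi.2] using hp i
    rw [hset, measure_empty]

lemma integrable_prod_piecewise_kernel (hn : 0 < n)
    (hcont : Continuous fun p : (∀ i, X i) × (∀ i, X i) => I p.1 p.2)
    (hI : IsCompleteNSymmetric I) (hPDI : IsPDI k I) (hd : VanishesOnExtendedDiagonal k I)
    {P Q : ProbabilityMeasure (∀ i, X i)} (hP : P ∈ IntegrableProbabilities I)
    (hQ : Q ∈ IntegrableProbabilities I)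
    (hPQ : MarginalsAgree k (P : Measure (∀ i, X i)) Q) (F G : Finset (Fin n)) (z : ∀ i, X i) :
    Integrable (fun p : (∀ i, X i) × (∀ i, X i) => I (F.piecewise p.1 z) (G.piecewise p.2 z))
      ((P : Measure (∀ i, X i)).prod (Q : Measure (∀ i, X i))) := by
  obtain ⟨C, hC, hbound⟩ := exists_abs_le_sum_base hI hPDI hd
  have hPc := hP.1.isConcentrated
  have hQc := hQ.1.isConcentrated
  have hmeas := aestronglyMeasurable_kernel hcont
    ((hPc.comp (Measure.quasiMeasurePreserving_fst (ν := (Q : Measure (∀ i, X i))))).piecewise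
      (isConcentrated_const _ z) F)
    ((hQc.comp (Measure.quasiMeasurePreserving_snd (μ := (P : Measure (∀ i, X i))))).piecewise
      (isConcentrated_const _ z) G)
  refine Integrable.mono' (Integrable.const_mul (integrable_finsetSum _ fun H hH =>
    integrable_finsetSum _ fun E hE => ?_) C) hmeas
    (Filter.Eventually.of_forall fun p => hbound (F.piecewise p.1 z) (G.piecewise p.2 z) z)
  have hpt : ∀ p : (∀ i, X i) × (∀ i, X i),
      E.piecewise (F.piecewise p.1 z) ((H \ E).piecewise (G.piecewise p.2 z) z) =
      (E ∩ F).piecewise p.1 (((H \ E) ∩ G).piecewise p.2 z) := by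
    intro p
    ext i
    by_cases hE : i ∈ E <;> by_cases hH : i ∈ H <;> by_cases hF : i ∈ F <;>
      by_cases hG : i ∈ G <;> simp [hE, hH, hF, hG]
  simp only [hpt]
  refine (integrable_prod_piecewise_piecewise hn hcont hP hQ hPQ ?_ ?_ z z).abs
  · exact (Finset.disjoint_sdiff.mono Finset.inter_subset_left Finset.inter_subset_left)
  · have h1 := Finset.card_le_card (Finset.inter_subset_left (s₁ := E) (s₂ := F))
    have h2 := Finset.card_le_card (Finset.inter_subset_left (s₁ := H \ E) (s₂ := G))
    have h3 := Finset.card_sdiff_add_card_eq_card (Finset.mem_powerset.1 hE)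
    have h4 := (Finset.mem_powersetCard.1 hH).2
    omega

lemma integrablePair_self (hn : 0 < n)
    (hcont : Continuous fun p : (∀ i, X i) × (∀ i, X i) => I p.1 p.2)
    (hI : IsCompleteNSymmetric I) (hPDI : IsPDI k I) (hd : VanishesOnExtendedDiagonal k I)
    {P Q : ProbabilityMeasure (∀ i, X i)} (hP : P ∈ IntegrableProbabilities I)
    (hQ : Q ∈ IntegrableProbabilities I)
    (hPQ : MarginalsAgree k (P : Measure (∀ i, X i)) Q) : IntegrablePair I P Q := by
  obtain ⟨x₀⟩ := P.nonempty
  refine ⟨fun z => ?_, fun z => ?_, ?_⟩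
  · simpa using integrable_of_mem_integrableProbabilities hn hcont hP Finset.univ x₀ z
  · simpa using integrable_of_mem_integrableProbabilities hn hcont hQ Finset.univ x₀ z
  · simpa using integrable_prod_piecewise_kernel hn hcont hI hPDI hd hP hQ hPQ Finset.univ
      Finset.univ x₀

lemma integrablePair_kernelK (hkn : k < n)
    (hcont : Continuous fun p : (∀ i, X i) × (∀ i, X i) => I p.1 p.2)
    (hI : IsCompleteNSymmetric I) (hPDI : IsPDI k I) (hd : VanishesOnExtendedDiagonal k I)
    {P Q : ProbabilityMeasure (∀ i, X i)} (hP : P ∈ IntegrableProbabilities I)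
    (hQ : Q ∈ IntegrableProbabilities I)
    (hPQ : MarginalsAgree k (P : Measure (∀ i, X i)) Q) (x₀ : ∀ i, X i) :
    IntegrablePair (kernelK k I x₀) P Q := by
  have hn : 0 < n := by omega
  simp only [IntegrablePair, kernelK_eq_sum hkn]
  refine ⟨fun z => ?_, fun z => ?_, ?_⟩ <;>
    refine integrable_finsetSum _ fun F _ => integrable_finsetSum _ fun G _ =>
      ((Integrable.const_mul ?_ _).const_mul _)
  · exact integrable_of_mem_integrableProbabilities hn hcont hP F x₀ _
  · exact integrable_of_mem_integrableProbabilities hn hcont hQ F x₀ _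
  · exact integrable_prod_piecewise_kernel hn hcont hI hPDI hd hP hQ hPQ F G x₀

/-- Integrability of a function of at most `k` coordinates with respect to the block products of a
mixture: either all of these coordinates lie in one block, or every block contains fewer than `k` of
them and the mixture may be replaced by one of its components. -/
lemma integrable_pi_mixture (hn : 0 < n)
    (hcont : Continuous fun p : (∀ i, X i) × (∀ i, X i) => I p.1 p.2)
    {P Q R : ProbabilityMeasure (∀ i, X i)} (hP : P ∈ IntegrableProbabilities I)
    (hQ : Q ∈ IntegrableProbabilities I) (hR : IsRadon (R : Measure (∀ i, X i))) {a b : NNReal}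
    (hRab : (R : Measure (∀ i, X i)) = a • (P : Measure (∀ i, X i)) + b • (Q : Measure (∀ i, X i)))
    (hPR : MarginalsAgree k (P : Measure (∀ i, X i)) R)
    (π : Finpartition (Finset.univ : Finset (Fin n))) {D : Finset (Fin n)} (hD : D.card ≤ k)
    (w z : ∀ i, X i) :
    Integrable (fun u : π.parts → ∀ i, X i => I (D.piecewise (blockPoint π u) w) z)
      (Measure.pi fun _ => (R : Measure (∀ i, X i))) := by
  by_cases hB : ∃ B ∈ π.parts, D ⊆ B
  · obtain ⟨B, hB, hDB⟩ := hB
    have h1 : Integrable (fun x => I (D.piecewise x w) z) (R : Measure (∀ i, X i)) := by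
      rw [hRab]
      exact .add_measure
        (integrable_of_mem_integrableProbabilities hn hcont hP D w z).smul_measure_nnreal
        (integrable_of_mem_integrableProbabilities hn hcont hQ D w z).smul_measure_nnreal
    have h2 := (measurePreserving_eval (fun _ : π.parts => (R : Measure (∀ i, X i)))
      ⟨B, hB⟩).integrable_comp_of_integrable h1
    refine h2.congr (Filter.Eventually.of_forall fun u => ?_)
    simp only [Function.comp_apply, Function.eval]
    congr 1
    ext i
    by_cases hi : i ∈ D
    · simp only [hi, Finset.piecewise_eq_of_mem, blockPoint]
      have hpart : π.part i = B := π.part_eq_of_mem hB (hDB hi)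
      subst hpart
      rfl
    · simp [hi]
  · push Not at hB
    have c1 := (isConcentrated_blockPoint hP.1.isConcentrated π).piecewise
      (isConcentrated_const _ w) D
    have c2 := (isConcentrated_blockPoint hR.isConcentrated π).piecewise
      (isConcentrated_const _ w) D
    refine (integrable_and_integral_eq_of_box_eq c1 c2 (fun A hA => ?_)
      (f := fun x => I x z) (hcont.comp (continuous_id.prodMk continuous_const))).1
      (hP.2 π D w z)
    rw [pi_blockPoint_box, pi_blockPoint_box]
    split_ifs with hw
    · refine Finset.prod_congr rfl fun B hBπ => hPR _ ?_ A hA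
      refine lt_of_lt_of_le (Finset.card_lt_card (lt_of_le_of_ne Finset.inter_subset_left ?_)) hD
      exact fun h => hB B hBπ (Finset.inter_eq_left.1 h)
    · rfl

lemma mixture_mem_integrableProbabilities (hn : 0 < n)
    (hcont : Continuous fun p : (∀ i, X i) × (∀ i, X i) => I p.1 p.2)
    (hI : IsCompleteNSymmetric I) (hPDI : IsPDI k I) (hd : VanishesOnExtendedDiagonal k I)
    {P Q R : ProbabilityMeasure (∀ i, X i)} (hP : P ∈ IntegrableProbabilities I)
    (hQ : Q ∈ IntegrableProbabilities I) (hR : IsRadon (R : Measure (∀ i, X i))) {a b : NNReal}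
    (hRab : (R : Measure (∀ i, X i)) = a • (P : Measure (∀ i, X i)) + b • (Q : Measure (∀ i, X i)))
    (hPR : MarginalsAgree k (P : Measure (∀ i, X i)) R) : R ∈ IntegrableProbabilities I := by
  obtain ⟨C, hC, hbound⟩ := exists_abs_le_sum_powersetCard hI hPDI hd
  refine ⟨hR, fun π F x₃ x₄ => ?_⟩
  have hmeas := ((isConcentrated_blockPoint hR.isConcentrated π).piecewise
    (isConcentrated_const _ x₃) F).aestronglyMeasurable (f := fun x => I x x₄)
    (hcont.comp (continuous_id.prodMk continuous_const))
  refine Integrable.mono' (Integrable.const_mul (integrable_finsetSum _ fun H hH => ?_) C) hmeas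
    (Filter.Eventually.of_forall fun u => hbound (F.piecewise (blockPoint π u) x₃) x₄)
  have hpt : ∀ u : π.parts → ∀ i, X i,
      H.piecewise (F.piecewise (blockPoint π u) x₃) x₄ =
      (H ∩ F).piecewise (blockPoint π u) (H.piecewise x₃ x₄) := by
    intro u
    ext i
    by_cases hH : i ∈ H <;> by_cases hF : i ∈ F <;> simp [hH, hF]
  simp only [hpt]
  refine (integrable_pi_mixture hn hcont hP hQ hR hRab hPR π ?_ _ _).abs
  exact (Finset.card_le_card Finset.inter_subset_left).trans (Finset.mem_powersetCard.1 hH).2.le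

lemma IsRadon.smul_nnreal {S : Type*} [TopologicalSpace S] [T2Space S] [MeasurableSpace S]
    [BorelSpace S] {μ : Measure S} [IsFiniteMeasure μ] (h : IsRadon μ) {c : NNReal} (hc : c ≤ 1) :
    IsRadon (c • μ) := by
  refine h.mono fun E => ?_
  rw [Measure.smul_apply]
  exact mul_le_of_le_one_left bot_le (by exact_mod_cast hc)

lemma convex_integrableClass (hn : 0 < n)
    (hcont : Continuous fun p : (∀ i, X i) × (∀ i, X i) => I p.1 p.2)
    (hI : IsCompleteNSymmetric I) (hPDI : IsPDI k I) (hd : VanishesOnExtendedDiagonal k I)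
    {P : ProbabilityMeasure (∀ i, X i)} (hP : P ∈ IntegrableProbabilities I) :
    Convex NNReal ((fun Q : ProbabilityMeasure (∀ i, X i) => (Q : Measure (∀ i, X i))) ''
      IntegrableClass k I P) := by
  rintro _ ⟨Q₁, hQ₁, rfl⟩ _ ⟨Q₂, hQ₂, rfl⟩ a b - - hab
  have hprob : IsProbabilityMeasure
      (a • (Q₁ : Measure (∀ i, X i)) + b • (Q₂ : Measure (∀ i, X i))) := by
    refine ⟨?_⟩
    rw [Measure.add_apply, Measure.smul_apply, Measure.smul_apply, measure_univ, measure_univ,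
      ← add_smul, hab, one_smul]
  let R : ProbabilityMeasure (∀ i, X i) := ⟨_, hprob⟩
  have hR : IsRadon (R : Measure (∀ i, X i)) :=
    (hQ₁.1.1.smul_nnreal (hab ▸ le_self_add)).add (hQ₂.1.1.smul_nnreal (hab ▸ le_add_self))
  have h1 := hQ₁.2.marginalsAgree
  have h2 := hQ₂.2.marginalsAgree
  have hPR : MarginalsAgree k (P : Measure (∀ i, X i)) R := by
    intro F hF A hA
    change _ = (a • (Q₁ : Measure (∀ i, X i)) + b • (Q₂ : Measure (∀ i, X i))) _
    rw [Measure.add_apply, Measure.smul_apply, Measure.smul_apply, ← h1 F hF A hA, ← h2 F hF A hA,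
      ← add_smul, hab, one_smul]
  exact ⟨R, ⟨mixture_mem_integrableProbabilities hn hcont hI hPDI hd hQ₁.1 hQ₂.1 hR rfl
    (h1.symm.trans hPR), hPR.radonM hP.1 hR⟩, rfl⟩

end Integrability

end PDI

/-! ### Mean embeddings and energies -/

namespace PDI

section ReproducingKernel

variable {S : Type*} {K : S → S → ℝ}

open RKHS in
/-- The reproducing kernel Hilbert space of a positive definite kernel exists. -/
lemma IsPD.exists_isRKHSOf.{u} {S : Type u} {K : S → S → ℝ} (hK : IsPD K) :
    ∃ (H : Type u) (_ : NormedAddCommGroup H) (_ : InnerProductSpace ℝ H) (_ : CompleteSpace H)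
      (_ : RKHS ℝ H S ℝ), IsRKHSOf H K := by
  let M : Matrix S S (ℝ →L[ℝ] ℝ) := Matrix.of fun x y => K x y • (1 : ℝ →L[ℝ] ℝ)
  have hM : M.PosSemidef := by
    have hiff := (posSemidef_tfae (K := M)).out 0 2
    refine hiff.2 ⟨?_, fun c => ?_⟩
    · ext x y
      simp [M, hK.1 x y]
    · refine (hK.2 c).trans (le_of_eq ?_)
      rw [discreteIntegral₂, RCLike.re_to_real]
      refine Finsupp.sum_congr fun x _ => Finsupp.sum_congr fun y _ => ?_
      simp [M, hK.1 y x]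
      ring
  have : Fact M.PosSemidef := ⟨hM⟩
  refine ⟨OfKernel M, inferInstance, inferInstance, inferInstance, inferInstance, fun x y => ?_⟩
  rw [OfKernel.kernel_ofKernel]
  simp [M]

variable {H : Type*} [NormedAddCommGroup H] [InnerProductSpace ℝ H] [CompleteSpace H]
  [RKHS ℝ H S ℝ]

lemma inner_kerFun_one (x : S) (f : H) : inner ℝ (RKHS.kerFun H x (1 : ℝ)) f = f x := by
  rw [RKHS.kerFun_inner]; simp

lemma IsRKHSOf.kerFun_one_apply (hH : IsRKHSOf H K) (x y : S) :
    RKHS.kerFun H y (1 : ℝ) x = K x y := by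
  rw [RKHS.kerFun_apply, hH]

lemma IsRKHSOf.inner_kerFun_kerFun (hH : IsRKHSOf H K) (x y : S) :
    inner ℝ (RKHS.kerFun H x (1 : ℝ)) (RKHS.kerFun H y (1 : ℝ)) = K x y := by
  rw [inner_kerFun_one, hH.kerFun_one_apply]

lemma IsRKHSOf.norm_kerFun_sq (hH : IsRKHSOf H K) (x : S) :
    ‖RKHS.kerFun H x (1 : ℝ)‖ ^ 2 = K x x := by
  rw [← real_inner_self_eq_norm_sq, hH.inner_kerFun_kerFun]

variable [TopologicalSpace S]

/-- The functions in the reproducing kernel Hilbert space of a continuous kernel are continuous. -/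
lemma IsRKHSOf.continuous (hH : IsRKHSOf H K) (hK : Continuous fun p : S × S => K p.1 p.2)
    (f : H) : Continuous f := by
  have hker : Continuous fun x : S => RKHS.kerFun H x (1 : ℝ) := by
    refine continuous_iff_continuousAt.2 fun x => tendsto_iff_norm_sub_tendsto_zero.2 ?_
    have hnorm : ∀ y, ‖RKHS.kerFun H y (1 : ℝ) - RKHS.kerFun H x (1 : ℝ)‖ =
        Real.sqrt (K y y - 2 * K y x + K x x) := by
      intro y
      rw [← hH.norm_kerFun_sq y, ← hH.norm_kerFun_sq x, ← hH.inner_kerFun_kerFun y x,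
        ← norm_sub_sq_real, Real.sqrt_sq (norm_nonneg _)]
    simp only [hnorm]
    have h1 : Continuous fun y => K y y := hK.comp (continuous_id.prodMk continuous_id)
    have h2 : Continuous fun y => K y x := hK.comp (continuous_id.prodMk continuous_const)
    have h3 : Continuous fun y => Real.sqrt (K y y - 2 * K y x + K x x) := by fun_prop
    have h4 := h3.tendsto x
    rwa [show K x x - 2 * K x x + K x x = 0 by ring, Real.sqrt_zero] at h4
  have : (f : S → ℝ) = fun x => inner ℝ (RKHS.kerFun H x (1 : ℝ)) f := by
    funext x; rw [inner_kerFun_one]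
  rw [this]
  exact hker.inner continuous_const

variable [MeasurableSpace S] [BorelSpace S]

/-- If the diagonal of the kernel is integrable, then integration is a bounded functional on the
reproducing kernel Hilbert space, since `|f x| ≤ ‖f‖ √(K x x)`; it is represented by the mean
embedding. -/
lemma IsRKHSOf.exists_mean (hH : IsRKHSOf H K) (hK : Continuous fun p : S × S => K p.1 p.2)
    (Q : ProbabilityMeasure S) (hint : Integrable (fun x => K x x) (Q : Measure S)) :
    ∃ m : H, (∀ f : H, inner ℝ m f = ∫ x, f x ∂(Q : Measure S)) ∧
      ∀ z, m z = meanEmbedding K Q z := by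
  have hbound : ∀ (f : H) (x : S), ‖f x‖ ≤ (1 + K x x) * ‖f‖ := by
    intro f x
    have h1 : ‖f x‖ ≤ ‖RKHS.kerFun H x (1 : ℝ)‖ * ‖f‖ := by
      rw [← inner_kerFun_one]; exact norm_inner_le_norm _ _
    refine h1.trans (mul_le_mul_of_nonneg_right ?_ (norm_nonneg _))
    rw [← hH.norm_kerFun_sq]
    nlinarith [sq_nonneg (‖RKHS.kerFun H x (1 : ℝ)‖ - 1)]
  -- `√t ≤ 1 + t` is used in place of the square root, which avoids its integrability.
  have hint1 : Integrable (fun x => 1 + K x x) (Q : Measure S) := (integrable_const 1).add hint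
  have hf : ∀ f : H, Integrable (fun x => f x) (Q : Measure S) := fun f =>
    Integrable.mono' (hint1.mul_const ‖f‖)
      (hH.continuous hK f).measurable.aestronglyMeasurable
      (Filter.Eventually.of_forall (hbound f))
  let L : H →ₗ[ℝ] ℝ :=
    { toFun := fun f => ∫ x, f x ∂(Q : Measure S)
      map_add' := fun f g => by
        simp only [RKHS.coe_add, Pi.add_apply]
        exact integral_add (hf f) (hf g)
      map_smul' := fun c f => by
        simp only [RKHS.coe_smul, Pi.smul_apply, RingHom.id_apply]
        exact integral_smul c _ }
  let L' : H →L[ℝ] ℝ := L.mkContinuous (∫ x, (1 + K x x) ∂(Q : Measure S)) fun f => by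
    refine (norm_integral_le_integral_norm _).trans ?_
    rw [← integral_mul_const]
    exact integral_mono (hf f).norm (hint1.mul_const _) (hbound f)
  have hm : ∀ f : H, inner ℝ ((InnerProductSpace.toDual ℝ H).symm L') f =
      ∫ x, f x ∂(Q : Measure S) := fun f => by
    rw [InnerProductSpace.toDual_symm_apply]; rfl
  refine ⟨(InnerProductSpace.toDual ℝ H).symm L', hm, fun z => ?_⟩
  rw [← inner_kerFun_one z, real_inner_comm, hm, meanEmbedding]
  simp only [hH.kerFun_one_apply]

end ReproducingKernel

section Energy

variable {n k : ℕ} {X : Fin n → Type*} [MeasurableSpace (∀ i, X i)]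

lemma integral_diff {P Q : ProbabilityMeasure (∀ i, X i)} {f : (∀ i, X i) → ℝ}
    (hP : Integrable f (P : Measure (∀ i, X i))) (hQ : Integrable f (Q : Measure (∀ i, X i))) :
    (∫ᵛ x, f x ∂<•(diff P Q)) =
      ∫ x, f x ∂(P : Measure (∀ i, X i)) - ∫ x, f x ∂(Q : Measure (∀ i, X i)) := by
  rw [diff, VectorMeasure.integral_sub_vectorMeasure, VectorMeasure.integral_toSignedMeasure,
    VectorMeasure.integral_toSignedMeasure]
  · rwa [VectorMeasure.Integrable, Measure.variation_toSignedMeasure]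
  · rwa [VectorMeasure.Integrable, Measure.variation_toSignedMeasure]

/-- The integral of `K(x, y)` for independent `x` and `y` with laws `P` and `Q`. -/
noncomputable def mutualEnergy (K : (∀ i, X i) → (∀ i, X i) → ℝ)
    (P Q : ProbabilityMeasure (∀ i, X i)) : ℝ :=
  ∫ p, K p.1 p.2 ∂((P : Measure (∀ i, X i)).prod (Q : Measure (∀ i, X i)))

/-- The expansion of `∫∫ K d(P - Q) d(P - Q)` into mutual energies. -/
noncomputable def energyDiff (K : (∀ i, X i) → (∀ i, X i) → ℝ)
    (P Q : ProbabilityMeasure (∀ i, X i)) : ℝ :=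
  mutualEnergy K P P - mutualEnergy K Q P - (mutualEnergy K P Q - mutualEnergy K Q Q)

lemma signedIntegral₂_diff {K : (∀ i, X i) → (∀ i, X i) → ℝ}
    {P Q : ProbabilityMeasure (∀ i, X i)} (hPQ : IntegrablePair K P Q)
    (hQP : IntegrablePair K Q P) (hPP : IntegrablePair K P P) (hQQ : IntegrablePair K Q Q) :
    signedIntegral₂ K (diff P Q) = energyDiff K P Q := by
  have hin : ∀ v, (∫ᵛ u, K u v ∂<•(diff P Q)) =
      ∫ u, K u v ∂(P : Measure (∀ i, X i)) - ∫ u, K u v ∂(Q : Measure (∀ i, X i)) := fun v =>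
    integral_diff (hPQ.1 v) (hPQ.2.1 v)
  have hswap : ∀ {R T : ProbabilityMeasure (∀ i, X i)}, IntegrablePair K R T →
      Integrable (fun v => ∫ u, K u v ∂(R : Measure (∀ i, X i))) (T : Measure (∀ i, X i)) ∧
      ∫ v, ∫ u, K u v ∂(R : Measure (∀ i, X i)) ∂(T : Measure (∀ i, X i)) = mutualEnergy K R T :=
    fun h => ⟨h.2.2.integral_prod_right, (integral_prod_symm _ h.2.2).symm⟩
  simp only [signedIntegral₂, hin]
  rw [integral_diff (f := fun v => ∫ u, K u v ∂(P : Measure (∀ i, X i)) -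
      ∫ u, K u v ∂(Q : Measure (∀ i, X i))) ((hswap hPP).1.sub (hswap hQP).1)
      ((hswap hPQ).1.sub (hswap hQQ).1), integral_sub (hswap hPP).1 (hswap hQP).1,
    integral_sub (hswap hPQ).1 (hswap hQQ).1,
    (hswap hPP).2, (hswap hQP).2, (hswap hPQ).2, (hswap hQQ).2, energyDiff]

lemma IsRKHSOf.energyDiff_eq_norm_sq {K : (∀ i, X i) → (∀ i, X i) → ℝ} {H : Type*}
    [NormedAddCommGroup H] [InnerProductSpace ℝ H] [CompleteSpace H] [RKHS ℝ H (∀ i, X i) ℝ]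
    {P Q : ProbabilityMeasure (∀ i, X i)} (hPQ : IntegrablePair K P Q)
    (hQP : IntegrablePair K Q P) (hPP : IntegrablePair K P P) (hQQ : IntegrablePair K Q Q)
    {f g : H} (hf : ∀ h : H, inner ℝ f h = ∫ x, h x ∂(P : Measure (∀ i, X i)))
    (hf' : ∀ z, f z = meanEmbedding K P z)
    (hg : ∀ h : H, inner ℝ g h = ∫ x, h x ∂(Q : Measure (∀ i, X i)))
    (hg' : ∀ z, g z = meanEmbedding K Q z) : energyDiff K P Q = ‖f - g‖ ^ 2 := by
  have hE : ∀ {R T : ProbabilityMeasure (∀ i, X i)}, IntegrablePair K R T →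
      ∫ v, meanEmbedding K R v ∂(T : Measure (∀ i, X i)) = mutualEnergy K R T :=
    fun h => (integral_prod_symm _ h.2.2).symm
  have h1 : inner ℝ f f = mutualEnergy K P P := by rw [hf]; simp only [hf']; exact hE hPP
  have h2 : inner ℝ f g = mutualEnergy K Q P := by rw [hf]; simp only [hg']; exact hE hQP
  have h3 : inner ℝ g f = mutualEnergy K P Q := by rw [hg]; simp only [hf']; exact hE hPQ
  have h4 : inner ℝ g g = mutualEnergy K Q Q := by rw [hg]; simp only [hg']; exact hE hQQ
  rw [← real_inner_self_eq_norm_sq, inner_sub_left, inner_sub_right, inner_sub_right, h1, h2, h3,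
    h4, energyDiff]

variable [∀ i, TopologicalSpace (X i)] [BorelSpace (∀ i, X i)]
  {I : (∀ i, X i) → (∀ i, X i) → ℝ}

lemma integrable_kernelK_diag (hkn : k < n)
    (hcont : Continuous fun p : (∀ i, X i) × (∀ i, X i) => I p.1 p.2)
    (hI : IsCompleteNSymmetric I) {P : ProbabilityMeasure (∀ i, X i)}
    (hP : P ∈ IntegrableProbabilities I) (x₀ : ∀ i, X i) :
    Integrable (fun x => kernelK k I x₀ x x) (P : Measure (∀ i, X i)) := by
  simp only [kernelK_eq_sum hkn, hI.piecewise_piecewise]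
  exact integrable_finsetSum _ fun F _ => integrable_finsetSum _ fun G _ =>
    ((integrable_of_mem_integrableProbabilities (by omega) hcont hP _ _ _).const_mul _).const_mul _

variable [∀ i, T2Space (X i)]

/-- A summand of `K^I` in which one argument enters only through fewer than `k` coordinates has no
energy against `P - Q`. -/
lemma energyDiff_piecewise_eq_zero (hn : 0 < n)
    (hcont : Continuous fun p : (∀ i, X i) × (∀ i, X i) => I p.1 p.2)
    (hI : IsCompleteNSymmetric I) (hPDI : IsPDI k I) (hd : VanishesOnExtendedDiagonal k I)
    {P Q : ProbabilityMeasure (∀ i, X i)} (hP : P ∈ IntegrableProbabilities I)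
    (hQ : Q ∈ IntegrableProbabilities I)
    (hPQ : MarginalsAgree k (P : Measure (∀ i, X i)) Q) {F G : Finset (Fin n)}
    (hFG : F.card < k ∨ G.card < k) (z : ∀ i, X i) :
    energyDiff (fun x y => I (F.piecewise x z) (G.piecewise y z)) P Q = 0 := by
  have hPQi := integrable_prod_piecewise_kernel hn hcont hI hPDI hd hP hQ hPQ F G z
  have hQPi := integrable_prod_piecewise_kernel hn hcont hI hPDI hd hQ hP hPQ.symm F G z
  have hPPi := integrable_prod_piecewise_kernel hn hcont hI hPDI hd hP hP (fun _ _ _ _ => rfl) F G z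
  have hQQi := integrable_prod_piecewise_kernel hn hcont hI hPDI hd hQ hQ (fun _ _ _ _ => rfl) F G z
  rw [energyDiff]
  simp only [mutualEnergy]
  rcases hFG with hF | hG
  · have h : ∀ w, ∫ x, I (F.piecewise x z) w ∂(P : Measure (∀ i, X i)) =
        ∫ x, I (F.piecewise x z) w ∂(Q : Measure (∀ i, X i)) := fun w =>
      hPQ.integral_piecewise_eq hP.1 hQ.1 hF z (f := fun x => I x w)
        (hcont.comp (continuous_id.prodMk continuous_const))
    rw [integral_prod_symm _ hPQi, integral_prod_symm _ hQPi, integral_prod_symm _ hPPi,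
      integral_prod_symm _ hQQi]
    simp only [h]
    ring
  · have h : ∀ w, ∫ x, I w (G.piecewise x z) ∂(P : Measure (∀ i, X i)) =
        ∫ x, I w (G.piecewise x z) ∂(Q : Measure (∀ i, X i)) := fun w =>
      hPQ.integral_piecewise_eq hP.1 hQ.1 hG z (f := fun x => I w x)
        (hcont.comp (continuous_const.prodMk continuous_id))
    rw [integral_prod _ hPQi, integral_prod _ hQPi, integral_prod _ hPPi, integral_prod _ hQQi]
    simp only [h]
    ring

lemma energyDiff_kernelK (hkn : k < n)
    (hcont : Continuous fun p : (∀ i, X i) × (∀ i, X i) => I p.1 p.2)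
    (hI : IsCompleteNSymmetric I) (hPDI : IsPDI k I) (hd : VanishesOnExtendedDiagonal k I)
    {P Q : ProbabilityMeasure (∀ i, X i)} (hP : P ∈ IntegrableProbabilities I)
    (hQ : Q ∈ IntegrableProbabilities I)
    (hPQ : MarginalsAgree k (P : Measure (∀ i, X i)) Q) (x₀ : ∀ i, X i) :
    energyDiff (kernelK k I x₀) P Q = energyDiff (fun x y => (-1 : ℝ) ^ k * I x y) P Q := by
  have hn : 0 < n := by omega
  have hexp : ∀ {R T : ProbabilityMeasure (∀ i, X i)}, R ∈ IntegrableProbabilities I →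
      T ∈ IntegrableProbabilities I → MarginalsAgree k (R : Measure (∀ i, X i)) T →
      mutualEnergy (kernelK k I x₀) R T = ∑ F : Finset (Fin n), ∑ G : Finset (Fin n),
        muCoeff n k F * muCoeff n k G * ((-1 : ℝ) ^ k *
          mutualEnergy (fun x y => I (F.piecewise x x₀) (G.piecewise y x₀)) R T) := by
    intro R T hR hT hRT
    have hint := fun F G =>
      integrable_prod_piecewise_kernel hn hcont hI hPDI hd hR hT hRT F G x₀
    simp only [mutualEnergy, kernelK_eq_sum hkn]
    rw [integral_finsetSum _ fun F _ => integrable_finsetSum _ fun G _ =>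
      ((hint F G).const_mul _).const_mul _]
    refine Finset.sum_congr rfl fun F _ => ?_
    rw [integral_finsetSum _ fun G _ => ((hint F G).const_mul _).const_mul _]
    refine Finset.sum_congr rfl fun G _ => ?_
    rw [integral_const_mul, integral_const_mul]
  have hsum : energyDiff (kernelK k I x₀) P Q = ∑ F : Finset (Fin n), ∑ G : Finset (Fin n),
      muCoeff n k F * muCoeff n k G * ((-1 : ℝ) ^ k *
        energyDiff (fun x y => I (F.piecewise x x₀) (G.piecewise y x₀)) P Q) := by
    rw [energyDiff, hexp hP hQ hPQ, hexp hQ hP hPQ.symm, hexp hP hP fun _ _ _ _ => rfl,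
      hexp hQ hQ fun _ _ _ _ => rfl]
    simp only [← Finset.sum_sub_distrib]
    refine Finset.sum_congr rfl fun F _ => Finset.sum_congr rfl fun G _ => ?_
    rw [energyDiff]
    ring
  have hcoeff : ∀ F : Finset (Fin n), F ≠ Finset.univ → ¬ F.card < k → muCoeff n k F = 0 :=
    fun F h1 h2 => by simp [muCoeff, h1, h2]
  have huniv : muCoeff n k (Finset.univ : Finset (Fin n)) = 1 := by
    simp [muCoeff, hkn.le]
  rw [hsum, Finset.sum_eq_single_of_mem Finset.univ (Finset.mem_univ _),
    Finset.sum_eq_single_of_mem Finset.univ (Finset.mem_univ _), huniv]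
  · simp only [Finset.piecewise_univ, energyDiff, mutualEnergy, integral_const_mul]
    ring
  · intro G _ hG
    by_cases h : G.card < k
    · rw [energyDiff_piecewise_eq_zero hn hcont hI hPDI hd hP hQ hPQ (Or.inr h)]; ring
    · rw [hcoeff G hG h]; ring
  · intro F _ hF
    refine Finset.sum_eq_zero fun G _ => ?_
    by_cases h : F.card < k
    · rw [energyDiff_piecewise_eq_zero hn hcont hI hPDI hd hP hQ hPQ (Or.inl h)]; ring
    · rw [hcoeff F hF h]; ring

end Energy

lemma continuous_kernelK {n k : ℕ} {X : Fin n → Type*} [∀ i, TopologicalSpace (X i)]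
    {I : (∀ i, X i) → (∀ i, X i) → ℝ} (hkn : k < n)
    (hcont : Continuous fun p : (∀ i, X i) × (∀ i, X i) => I p.1 p.2) (x₀ : ∀ i, X i) :
    Continuous fun p : (∀ i, X i) × (∀ i, X i) => kernelK k I x₀ p.1 p.2 := by
  simp only [kernelK_eq_sum hkn]
  refine continuous_finsetSum _ fun F _ => continuous_finsetSum _ fun G _ =>
    continuous_const.mul (continuous_const.mul (hcont.comp (Continuous.prodMk ?_ ?_)))
  · exact (continuous_piecewise_left F x₀).comp continuous_fst
  · exact (continuous_piecewise_left G x₀).comp continuous_snd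

end PDI

/-! ### Convexity, energy and the semi-metric -/

theorem theorem4p10 {n k : ℕ} (hkn : k < n) {X : Fin n → Type*}
    [∀ i, TopologicalSpace (X i)] [∀ i, T2Space (X i)]
    [MeasurableSpace (∀ i, X i)] [BorelSpace (∀ i, X i)]
    (I : (∀ i, X i) → (∀ i, X i) → ℝ)
    (hcont : Continuous fun p : (∀ i, X i) × (∀ i, X i) => I p.1 p.2)
    (hsymm : PDI.IsCompleteNSymmetric I)
    (hPDI : PDI.IsPDI k I)
    (hdiag : PDI.VanishesOnExtendedDiagonal k I)
    (P : ProbabilityMeasure (∀ i, X i)) (hP : P ∈ PDI.IntegrableProbabilities I) :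
    -- the class of `P` is convex
    Convex NNReal
      ((fun Q : ProbabilityMeasure (∀ i, X i) => (Q : Measure (∀ i, X i))) ''
        PDI.IntegrableClass k I P) ∧
    -- the integrals converge absolutely (`μ = η` is allowed), and the energy is the squared
    -- distance in the reproducing kernel Hilbert space of `K^I`, for every base point
    (∀ μ ∈ PDI.IntegrableClass k I P, ∀ η ∈ PDI.IntegrableClass k I P,
      PDI.IntegrablePair I μ η ∧
      0 ≤ PDI.signedIntegral₂ (fun u v => (-1 : ℝ) ^ k * I u v) (PDI.diff μ η) ∧
      ∀ x₀ : ∀ i, X i,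
        PDI.IsPD (PDI.kernelK k I x₀) ∧
        PDI.IntegrablePair (PDI.kernelK k I x₀) μ η ∧
        PDI.signedIntegral₂ (fun u v => (-1 : ℝ) ^ k * I u v) (PDI.diff μ η) =
          PDI.signedIntegral₂ (PDI.kernelK k I x₀) (PDI.diff μ η) ∧
        ∀ (H : Type*) [NormedAddCommGroup H] [InnerProductSpace ℝ H] [CompleteSpace H]
          [RKHS ℝ H (∀ i, X i) ℝ], PDI.IsRKHSOf H (PDI.kernelK k I x₀) →
          ∃ f g : H,
            (∀ z, f z = PDI.meanEmbedding (PDI.kernelK k I x₀) μ z) ∧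
            (∀ z, g z = PDI.meanEmbedding (PDI.kernelK k I x₀) η z) ∧
            PDI.signedIntegral₂ (PDI.kernelK k I x₀) (PDI.diff μ η) = ‖f - g‖ ^ 2) ∧
    -- the square root of the energy is a semi-metric
    PDI.IsSemimetricOn (PDI.IntegrableClass k I P) (fun μ η =>
      Real.sqrt (PDI.signedIntegral₂ (fun u v => (-1 : ℝ) ^ k * I u v) (PDI.diff μ η))) := by
  have hn : 0 < n := by omega
  have hagree : ∀ {μ η : ProbabilityMeasure (∀ i, X i)}, μ ∈ PDI.IntegrableClass k I P →
      η ∈ PDI.IntegrableClass k I P →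
      PDI.MarginalsAgree k (μ : Measure (∀ i, X i)) η := fun hμ hη =>
    hμ.2.marginalsAgree.symm.trans hη.2.marginalsAgree
  have hpI : ∀ {μ η : ProbabilityMeasure (∀ i, X i)}, μ ∈ PDI.IntegrableClass k I P →
      η ∈ PDI.IntegrableClass k I P → PDI.IntegrablePair I μ η := fun hμ hη =>
    PDI.integrablePair_self hn hcont hsymm hPDI hdiag hμ.1 hη.1 (hagree hμ hη)
  have hpI' : ∀ {μ η : ProbabilityMeasure (∀ i, X i)}, μ ∈ PDI.IntegrableClass k I P →
      η ∈ PDI.IntegrableClass k I P →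
      PDI.IntegrablePair (fun u v => (-1 : ℝ) ^ k * I u v) μ η := fun hμ hη =>
    ⟨fun z => ((hpI hμ hη).1 z).const_mul _, fun z => ((hpI hμ hη).2.1 z).const_mul _,
      (hpI hμ hη).2.2.const_mul _⟩
  have hpK : ∀ (x₀ : ∀ i, X i) {μ η : ProbabilityMeasure (∀ i, X i)},
      μ ∈ PDI.IntegrableClass k I P → η ∈ PDI.IntegrableClass k I P →
      PDI.IntegrablePair (PDI.kernelK k I x₀) μ η := fun x₀ _ _ hμ hη =>
    PDI.integrablePair_kernelK hkn hcont hsymm hPDI hdiag hμ.1 hη.1 (hagree hμ hη) x₀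
  have hEK : ∀ (x₀ : ∀ i, X i) {μ η : ProbabilityMeasure (∀ i, X i)},
      μ ∈ PDI.IntegrableClass k I P → η ∈ PDI.IntegrableClass k I P →
      PDI.signedIntegral₂ (PDI.kernelK k I x₀) (PDI.diff μ η) =
        PDI.energyDiff (PDI.kernelK k I x₀) μ η := fun x₀ _ _ hμ hη =>
    PDI.signedIntegral₂_diff (hpK x₀ hμ hη) (hpK x₀ hη hμ) (hpK x₀ hμ hμ) (hpK x₀ hη hη)
  have hEI : ∀ (x₀ : ∀ i, X i) {μ η : ProbabilityMeasure (∀ i, X i)},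
      μ ∈ PDI.IntegrableClass k I P → η ∈ PDI.IntegrableClass k I P →
      PDI.signedIntegral₂ (fun u v => (-1 : ℝ) ^ k * I u v) (PDI.diff μ η) =
        PDI.energyDiff (PDI.kernelK k I x₀) μ η := fun x₀ _ _ hμ hη => by
    rw [PDI.energyDiff_kernelK hkn hcont hsymm hPDI hdiag hμ.1 hη.1 (hagree hμ hη)]
    exact PDI.signedIntegral₂_diff (hpI' hμ hη) (hpI' hη hμ) (hpI' hμ hμ) (hpI' hη hη)
  -- A single reproducing kernel Hilbert space, for an arbitrary base point, realizes the square
  -- root of the energy as a distance.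
  obtain ⟨b⟩ := P.nonempty
  obtain ⟨H₀, i1, i2, i3, i4, hH₀⟩ :=
    (PDI.isPD_kernelK hkn hsymm hPDI b).exists_isRKHSOf
  have hmean : ∀ μ : ProbabilityMeasure (∀ i, X i), ∃ m : H₀, μ ∈ PDI.IntegrableClass k I P →
      (∀ f : H₀, inner ℝ m f = ∫ x, f x ∂(μ : Measure (∀ i, X i))) ∧
        ∀ z, m z = PDI.meanEmbedding (PDI.kernelK k I b) μ z := by
    intro μ
    by_cases hμ : μ ∈ PDI.IntegrableClass k I P
    · obtain ⟨m, hm⟩ := hH₀.exists_mean (PDI.continuous_kernelK hkn hcont b) μ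
        (PDI.integrable_kernelK_diag hkn hcont hsymm hμ.1 b)
      exact ⟨m, fun _ => hm⟩
    · exact ⟨0, fun h => absurd h hμ⟩
  choose m hm using hmean
  have hdist : ∀ {μ η : ProbabilityMeasure (∀ i, X i)}, μ ∈ PDI.IntegrableClass k I P →
      η ∈ PDI.IntegrableClass k I P →
      PDI.signedIntegral₂ (fun u v => (-1 : ℝ) ^ k * I u v) (PDI.diff μ η) =
        ‖m μ - m η‖ ^ 2 := fun {μ η} hμ hη => by
    rw [hEI b hμ hη]
    exact PDI.IsRKHSOf.energyDiff_eq_norm_sq (hpK b hμ hη) (hpK b hη hμ) (hpK b hμ hμ)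
      (hpK b hη hη) (hm μ hμ).1 (hm μ hμ).2 (hm η hη).1 (hm η hη).2
  refine ⟨PDI.convex_integrableClass hn hcont hsymm hPDI hdiag hP, fun μ hμ η hη => ?_, ?_⟩
  · refine ⟨hpI hμ hη, ?_, fun x₀ => ?_⟩
    · rw [hdist hμ hη]; positivity
    refine ⟨PDI.isPD_kernelK hkn hsymm hPDI x₀, hpK x₀ hμ hη, ?_, ?_⟩
    · rw [hEI x₀ hμ hη, hEK x₀ hμ hη]
    · intro H _ _ _ _ hH
      obtain ⟨f, hf, hf'⟩ := hH.exists_mean (PDI.continuous_kernelK hkn hcont x₀) μ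
        (PDI.integrable_kernelK_diag hkn hcont hsymm hμ.1 x₀)
      obtain ⟨g, hg, hg'⟩ := hH.exists_mean (PDI.continuous_kernelK hkn hcont x₀) η
        (PDI.integrable_kernelK_diag hkn hcont hsymm hη.1 x₀)
      refine ⟨f, g, hf', hg', ?_⟩
      rw [hEK x₀ hμ hη]
      exact PDI.IsRKHSOf.energyDiff_eq_norm_sq (hpK x₀ hμ hη) (hpK x₀ hη hμ) (hpK x₀ hμ hμ)
        (hpK x₀ hη hη) hf hf' hg hg'
  · have hsqrt : ∀ {μ η : ProbabilityMeasure (∀ i, X i)}, μ ∈ PDI.IntegrableClass k I P →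
        η ∈ PDI.IntegrableClass k I P →
        Real.sqrt (PDI.signedIntegral₂ (fun u v => (-1 : ℝ) ^ k * I u v) (PDI.diff μ η)) =
          ‖m μ - m η‖ := fun hμ hη => by
      rw [hdist hμ hη, Real.sqrt_sq (norm_nonneg _)]
    refine ⟨fun μ _ η _ => Real.sqrt_nonneg _, fun μ hμ => ?_, fun μ hμ η hη => ?_,
      fun μ hμ η hη ρ hρ => ?_⟩
    · beta_reduce
      rw [hsqrt hμ hμ, sub_self, norm_zero]
    · beta_reduce
      rw [hsqrt hμ hη, hsqrt hη hμ, norm_sub_rev]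
    · beta_reduce
      rw [hsqrt hμ hρ, hsqrt hμ hη, hsqrt hη hρ]
      exact norm_sub_le_norm_sub_add_norm_sub _ _ _
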